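/- Let $n\ge 1$, $T>0$, let $\Omega\subset\mathbb R^n$ be open and bounded with locally Lipschitz boundary, and let $r\in\mathbb R$ satisfy $r\ge 2$ and $r>n$. For $1\le p<\infty$ let $W_0^{1,p}(\Omega)$ be the closure of $C_c^\infty(\Omega)$ in $W^{1,p}(\Omega)$, let $H_0^1(\Omega)=W_0^{1,2}(\Omega)$, and let $$X_r=H^1(0,T;W_0^{1,r}(\Omega))=\{y\in L^2(0,T;W_0^{1,r}(\Omega)) : \partial_t y\in L^2(0,T;W_0^{1,r}(\Omega))\},$$ where $\partial_t$ is the weak (Bochner) time derivative. Let $f:[0,T]\times\Omega\times\mathbb R\to\mathbb R$ be such that $(t,x)\mapsto f(t,x,u)$ is measurable for every $u\in\mathbb R$, and such that: - for almost all $(t,x)$ the map $u\mapsto f(t,x,u)$ is continuous, and for every compact $K\subset\mathbb R$ there is $M_K\ge 0$ such that $\sup_{u\in K}|f(t,x,u)|\le M_K$ for almost all $(t,x)$; - for every compact $K\subset\mathbb R$ there is $L_K\ge0$ such that for almost all $(t,x)$ and all $u,v\in K$, $(u-v)(f(t,x,u)-f(t,x,v))\le L_K(u-v)^2$. Let $y_0\in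 W_0^{1,r}(\Omega)$ and let $y^*\in X_r$ be a weak solution of $\partial_t y-\Delta y=f(t,x,y)$ in $(0,T)\times\Omega$ with $y=0$ on $\partial\Omega$ and $y(0,\cdot)=y_0$; that is, for all $v\in H_0^1(\Omega)$ and $\varphi\in C_c^\infty((0,T))$, $$\int_0^T\!\!\int_\Omega \varphi(t)\bigl[v(x)\,\partial_t y^*(t,x)+\nabla v(x)\cdot\nabla_x y^*(t,x)-v(x)f(t,x,y^*(t,x))\bigr]\,dx\,dt=0,$$ and the representative of $y^*$ in $C([0,T];W_0^{1,r}(\Omega))$ takes the value $y_0$ at $t=0$. Then $(y^*)^2\in X_r$, and for all $v\in H^1_0(\Omega)$ and all $\varphi\in C_c^\infty((0,T))$ the following iterated integrals converge and $$\int_0^T\!\!\int_\Omega \varphi(t)\Bigl[v(x)\,\partial_t\bigl((y^*)^2\bigr)(t,x)+\nabla v(x)\cdot\nabla_x\bigl((y^*)^2\bigr)(t,x)-2v(x)y^*(t,x)f(t,x,y^*(t,x))+2v(x)\|\nabla_x y^*(t,x)\|^2\Bigr]dx\,dt=0,$$ $$\int_0^T\!\!\int_\Omega \varphi(t)\bigl(\partial_t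 y^*(t,x)\bigr)^2-\tfrac12\varphi'(t)\|\nabla_x y^*(t,x)\|^2-\varphi(t)\,\partial_t y^*(t,x)\,f(t,x,y^*(t,x))\,dx\,dt=0.$$ -/

import Mathlib

open MeasureTheory Set

open scoped ContDiff NNReal ENNReal RealInnerProductSpace

noncomputable section

namespace ReactionDiffusion

/-- The Euclidean space `ℝⁿ`. -/
abbrev Euc (n : ℕ) := EuclideanSpace ℝ (Fin n)

/-- `Ω` has a locally Lipschitz boundary: near each boundary point `p`, and with respect to a
suitable unit "vertical" direction `e`, the set `Ω` is the strict epigraph of a Lipschitz function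
`γ` of the horizontal variables (i.e. `γ` is invariant under translation along `e`). -/
def HasLipschitzBoundary {n : ℕ} (Ω : Set (Euc n)) : Prop :=
  ∀ p ∈ frontier Ω, ∃ e : Euc n, ‖e‖ = 1 ∧
    ∃ (K : ℝ≥0) (γ : Euc n → ℝ), LipschitzWith K γ ∧ (∀ x (s : ℝ), γ (x + s • e) = γ x) ∧
      ∃ ρ > 0, ∀ x ∈ Metric.ball p ρ, x ∈ Ω ↔ γ x < ⟪e, x⟫

/-! ### The spaces `W₀^{1,p}(Ω)` -/

/-- The pairs `(φ, ∇φ)`, `φ ∈ C_c^∞(Ω)`, as a subspace of `L^p(Ω) × L^p(Ω)ⁿ`. -/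
def testPairs {n : ℕ} (p : ℝ≥0∞) [Fact (1 ≤ p)] (Ω : Set (Euc n)) :
    Submodule ℝ (Lp ℝ p (volume.restrict Ω) × Lp (Euc n) p (volume.restrict Ω)) where
  carrier := {w | ∃ φ : Euc n → ℝ, ContDiff ℝ ∞ φ ∧ HasCompactSupport φ ∧ tsupport φ ⊆ Ω ∧
    w.1 =ᵐ[volume.restrict Ω] φ ∧ w.2 =ᵐ[volume.restrict Ω] gradient φ}
  zero_mem' := by
    refine ⟨0, contDiff_const, HasCompactSupport.zero, by simp [tsupport], ?_, ?_⟩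
    · exact Lp.coeFn_zero _ _ _
    · filter_upwards [Lp.coeFn_zero (Euc n) p (volume.restrict Ω)] with x hx
      have h0 : gradient (0 : Euc n → ℝ) x = 0 := by simp [gradient]
      rw [h0]
      exact hx
  add_mem' := by
    rintro a b ⟨φ, h1, h2, h3, h4, h5⟩ ⟨ψ, k1, k2, k3, k4, k5⟩
    refine ⟨φ + ψ, h1.add k1, h2.add k2,
      (tsupport_add φ ψ).trans (union_subset h3 k3), ?_, ?_⟩
    · exact (Lp.coeFn_add a.1 b.1).trans (h4.add k4)
    · refine (Lp.coeFn_add a.2 b.2).trans ((h5.add k5).trans (Filter.Eventually.of_forall ?_))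
      intro x
      simp [gradient, fderiv_add (h1.differentiable (by simp) x) (k1.differentiable (by simp) x)]
  smul_mem' := by
    rintro c a ⟨φ, h1, h2, h3, h4, h5⟩
    refine ⟨c • φ, h1.const_smul c, h2.smul_left (f := fun _ => c),
      (closure_mono (Function.support_const_smul_subset c φ)).trans h3, ?_, ?_⟩
    · exact (Lp.coeFn_smul c a.1).trans (h4.const_smul c)
    · refine (Lp.coeFn_smul c a.2).trans ((h5.const_smul c).trans (Filter.Eventually.of_forall ?_))
      intro x
      simp [gradient, fderiv_const_smul (h1.differentiable (by simp) x)]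

/-- The Sobolev space `W₀^{1,p}(Ω)`, the closure of `C_c^∞(Ω)` for the `W^{1,p}(Ω)` norm.
A Sobolev function `u` is represented by the pair `(u, ∇u) ∈ L^p(Ω) × L^p(Ω)ⁿ` formed with its weak
gradient; the norm of the product, `max (‖u‖_p) (‖∇u‖_p)`, is equivalent to the usual one. -/
def W0 {n : ℕ} (p : ℝ≥0∞) [Fact (1 ≤ p)] (Ω : Set (Euc n)) :
    Submodule ℝ (Lp ℝ p (volume.restrict Ω) × Lp (Euc n) p (volume.restrict Ω)) :=
  (testPairs p Ω).topologicalClosure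

instance {n : ℕ} (p : ℝ≥0∞) [Fact (1 ≤ p)] (Ω : Set (Euc n)) : CompleteSpace (W0 p Ω) :=
  inferInstanceAs (CompleteSpace (testPairs p Ω).topologicalClosure)

/-- The function `u` itself (an almost everywhere representative on `Ω`). -/
def sobFn {n : ℕ} {p : ℝ≥0∞} [Fact (1 ≤ p)] {Ω : Set (Euc n)} (u : W0 p Ω) : Euc n → ℝ :=
  (u : Lp ℝ p (volume.restrict Ω) × Lp (Euc n) p (volume.restrict Ω)).1

/-- The weak gradient `∇u` (an almost everywhere representative on `Ω`). -/
def sobGrad {n : ℕ} {p : ℝ≥0∞} [Fact (1 ≤ p)] {Ω : Set (Euc n)} (u : W0 p Ω) : Euc n → Euc n :=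
  (u : Lp ℝ p (volume.restrict Ω) × Lp (Euc n) p (volume.restrict Ω)).2

/-- `H₀¹(Ω) = W₀^{1,2}(Ω)`. -/
abbrev H10 {n : ℕ} (Ω : Set (Euc n)) := W0 2 Ω

/-! ### Bochner-Sobolev spaces in time -/

/-- `φ ∈ C_c^∞((0,T))`. -/
def IsTimeTest (T : ℝ) (φ : ℝ → ℝ) : Prop :=
  ContDiff ℝ ∞ φ ∧ HasCompactSupport φ ∧ tsupport φ ⊆ Ioo 0 T

/-- An element of the Bochner-Sobolev space `H¹(0,T;B)`, given by representatives: `val` is in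
`L²(0,T;B)`, and so is its weak time derivative `dt`, which is unique up to null sets. -/
structure H1Bochner (T : ℝ) (B : Type*) [NormedAddCommGroup B] [NormedSpace ℝ B] where
  val : ℝ → B
  dt : ℝ → B
  memLp_val : MemLp val 2 (volume.restrict (Ioo 0 T))
  memLp_dt : MemLp dt 2 (volume.restrict (Ioo 0 T))
  weak_deriv : ∀ φ : ℝ → ℝ, IsTimeTest T φ →
    ∫ t in Ioo 0 T, deriv φ t • val t = - ∫ t in Ioo 0 T, φ t • dt t

instance {r : ℝ} [hr : Fact (2 ≤ r)] : Fact (1 ≤ ENNReal.ofReal r) :=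
  ⟨by rw [ENNReal.one_le_ofReal]; linarith [hr.out]⟩

/-- The solution space `X_r = H¹(0,T;W₀^{1,r}(Ω))`. -/
abbrev Xr {n : ℕ} (T r : ℝ) [Fact (2 ≤ r)] (Ω : Set (Euc n)) :=
  H1Bochner T (W0 (ENNReal.ofReal r) Ω)

section slices

variable {n : ℕ} {T r : ℝ} [Fact (2 ≤ r)] {Ω : Set (Euc n)}

/-- `(t,x) ↦ y(t,x)`. -/
def Xr.fn (y : Xr T r Ω) (t : ℝ) (x : Euc n) : ℝ := sobFn (y.val t) x

/-- `(t,x) ↦ ∂ₜ y(t,x)`. -/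
def Xr.timeDeriv (y : Xr T r Ω) (t : ℝ) (x : Euc n) : ℝ := sobFn (y.dt t) x

/-- `(t,x) ↦ ∇ₓ y(t,x)`. -/
def Xr.spaceGrad (y : Xr T r Ω) (t : ℝ) (x : Euc n) : Euc n := sobGrad (y.val t) x

end slices

/-! ### The reaction term and weak solutions -/

/-- Lebesgue measure on `(0,T) × Ω`. -/
def cylMeasure {n : ℕ} (T : ℝ) (Ω : Set (Euc n)) : Measure (ℝ × Euc n) :=
  (volume.restrict (Ioo 0 T)).prod (volume.restrict Ω)

/-- `f(t,x,y)` is a Carathéodory function (measurable in `(t,x)`, continuous in `y`), essentially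
bounded in `(t,x)` and locally bounded in `y`. -/
structure IsLocallyBounded {n : ℕ} (T : ℝ) (Ω : Set (Euc n)) (f : ℝ → Euc n → ℝ → ℝ) : Prop where
  measurable : ∀ y : ℝ, AEMeasurable (fun q : ℝ × Euc n => f q.1 q.2 y) (cylMeasure T Ω)
  continuous : ∀ᵐ q ∂(cylMeasure T Ω), Continuous (f q.1 q.2)
  bounded : ∀ K : Set ℝ, IsCompact K →
    ∃ M : ℝ, 0 ≤ M ∧ ∀ᵐ q ∂(cylMeasure T Ω), ∀ y ∈ K, |f q.1 q.2 y| ≤ M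

/-- `f` is locally one-sided Lipschitz in `y`, essentially in `(t,x)`. -/
def IsLocallyOneSidedLipschitz {n : ℕ} (T : ℝ) (Ω : Set (Euc n)) (f : ℝ → Euc n → ℝ → ℝ) : Prop :=
  ∀ K : Set ℝ, IsCompact K → ∃ L : ℝ, 0 ≤ L ∧ ∀ᵐ q ∂(cylMeasure T Ω), ∀ u ∈ K, ∀ v ∈ K,
    (u - v) * (f q.1 q.2 u - f q.1 q.2 v) ≤ L * (u - v) ^ 2

/-- `y ∈ X_r` is a weak solution of `∂ₜ y - Δ y = f(t,x,y)` on `(0,T) × Ω` with homogeneous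
Dirichlet boundary condition and initial condition `y₀`. The initial value of `y` is that of its
continuous representative in `C([0,T];W₀^{1,r}(Ω))`. -/
structure IsWeakSolution {n : ℕ} {T r : ℝ} [Fact (2 ≤ r)] {Ω : Set (Euc n)}
    (f : ℝ → Euc n → ℝ → ℝ) (y₀ : W0 (ENNReal.ofReal r) Ω) (y : Xr T r Ω) : Prop where
  weak_eq : ∀ (v : H10 Ω) (φ : ℝ → ℝ), IsTimeTest T φ →
    ∫ t in Ioo 0 T, ∫ x in Ω, φ t * (sobFn v x * y.timeDeriv t x + ⟪sobGrad v x, y.spaceGrad t x⟫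
      - sobFn v x * f t x (y.fn t x)) = 0
  initial : ∃ yc : ℝ → W0 (ENNReal.ofReal r) Ω, ContinuousOn yc (Icc 0 T) ∧
    (yc =ᵐ[volume.restrict (Ioo 0 T)] y.val) ∧ yc 0 = y₀

/-- The iterated integral `∫_0^T ∫_Ω F(t,x) dx dt` converges, and its value is `0`. -/
def IteratedIntegralEqZero {n : ℕ} (T : ℝ) (Ω : Set (Euc n)) (F : ℝ → Euc n → ℝ) : Prop :=
  (∀ᵐ t ∂(volume.restrict (Ioo 0 T)), IntegrableOn (F t) Ω) ∧
    IntegrableOn (fun t => ∫ x in Ω, F t x) (Ioo 0 T) ∧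
    ∫ t in Ioo 0 T, ∫ x in Ω, F t x = 0

end ReactionDiffusion

end

open ReactionDiffusion

noncomputable section

open Filter Topology

namespace ReactionDiffusion

section

variable {T : ℝ} {B : Type*} [NormedAddCommGroup B] [NormedSpace ℝ B]

/-! Since `r > n`, Morrey's inequality (`exists_enorm_le_eLpNorm_gradient`) embeds W₀^{1,r}(Ω) into
L^∞, so pointwise multiplication `sobMul` is a bounded bilinear map of W₀^{1,r}(Ω) into itself. An
element of H¹(0,T;B) is almost everywhere a primitive of its weak derivative
(`H1Bochner.exists_isPrimitive`), and Fubini on a triangle gives a product rule for any bounded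
bilinear map (`IsPrimitive.bilin`). As y is bounded in time with values in W₀^{1,r}, it follows that
y² lies in X_r, with derivative 2y∂ₜy.

Both identities are proved on time slices. Test functions φ(t)v(x) separate the variables, and
H₀¹(Ω) is separable, so for almost every t the equation ∫ v(∂ₜy − f) + ∇v·∇y = 0 holds for all v at
once (`IsWeakSolution.ae_weak_eq`).

For the energy identity the slice equation is tested with ψy, ψ ∈ C_c^∞(Ω), which is admissible
because W₀^{1,r} is closed under products. This gives ∫ ψ|∇y|² = ℓ(ψ), with ℓ a bounded functional
on H₀¹. The weight |∇y|² is nonnegative: inserting a smoothed |ψ| bounds ∫ |ψ||∇y|² by ‖ℓ‖‖ψ‖, and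
Fatou's lemma extends integrability and the identity to every v ∈ H₀¹ (`integral_sobFn_mul_eq`). No
Sobolev embedding of H₀¹ enters.

For the dissipation identity the slice equation is tested with ∂ₜy(t) itself. The term ∫ ∇∂ₜy·∇y is
half the time derivative of the Dirichlet form at y, and the product rule moves that derivative onto
φ. -/

theorem H1Bochner.integrable_dt (y : H1Bochner T B) :
    Integrable y.dt (volume.restrict (Ioo 0 T)) := y.memLp_dt.integrable (by norm_num)

theorem H1Bochner.integrable_val (y : H1Bochner T B) :
    Integrable y.val (volume.restrict (Ioo 0 T)) := y.memLp_val.integrable (by norm_num)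

theorem H1Bochner.integrable_clm_dt (y : H1Bochner T B) (ℓ : B →L[ℝ] ℝ) :
    Integrable (fun t => ℓ (y.dt t)) (volume.restrict (Ioo 0 T)) :=
  ℓ.integrable_comp y.integrable_dt

theorem H1Bochner.integrable_clm_val (y : H1Bochner T B) (ℓ : B →L[ℝ] ℝ) :
    Integrable (fun t => ℓ (y.val t)) (volume.restrict (Ioo 0 T)) :=
  ℓ.integrable_comp y.integrable_val

end

/-! ### Primitives, weak time derivatives and the product rule. -/

section Time

variable {B₁ B₂ E : Type*} [NormedAddCommGroup B₁] [NormedSpace ℝ B₁] [CompleteSpace B₁]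
  [NormedAddCommGroup B₂] [NormedSpace ℝ B₂] [CompleteSpace B₂]
  [NormedAddCommGroup E] [NormedSpace ℝ E] [CompleteSpace E]

/-- Integration by parts for two primitives, in bilinear form. -/
theorem bilin_integral_eq_integral_primitive (μ : Measure ℝ) [SFinite μ] [NullSingletonClass μ]
    (b : B₁ →L[ℝ] B₂ →L[ℝ] E) {g₁ : ℝ → B₁} {g₂ : ℝ → B₂}
    (h₁ : Integrable g₁ μ) (h₂ : Integrable g₂ μ) :
    Integrable (fun s => b (g₁ s) (∫ t in Iic s, g₂ t ∂μ)) μ ∧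
    Integrable (fun s => b (∫ t in Iic s, g₁ t ∂μ) (g₂ s)) μ ∧
    b (∫ s, g₁ s ∂μ) (∫ s, g₂ s ∂μ) =
      (∫ s, b (g₁ s) (∫ t in Iic s, g₂ t ∂μ) ∂μ) +
        ∫ s, b (∫ t in Iic s, g₁ t ∂μ) (g₂ s) ∂μ := by
  have hint : Integrable (fun q : ℝ × ℝ => b (g₁ q.1) (g₂ q.2)) (μ.prod μ) :=
    h₁.op_fst_snd (op := fun x y => b x y) (by fun_prop) ⟨‖b‖, b.le_opNorm₂⟩ h₂
  set S : Set (ℝ × ℝ) := {q | q.2 ≤ q.1} with hS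
  have hSm : MeasurableSet S := measurableSet_le measurable_snd measurable_fst
  have e1 : ∀ s, ∫ t, S.indicator (fun q : ℝ × ℝ => b (g₁ q.1) (g₂ q.2)) (s, t) ∂μ
      = b (g₁ s) (∫ t in Iic s, g₂ t ∂μ) := by
    intro s
    rw [← ContinuousLinearMap.integral_comp_comm _ h₂.integrableOn,
      ← integral_indicator measurableSet_Iic]
    congr 1
  have e2 : ∀ t, ∫ s, Sᶜ.indicator (fun q : ℝ × ℝ => b (g₁ q.1) (g₂ q.2)) (s, t) ∂μ
      = b (∫ s in Iic t, g₁ s ∂μ) (g₂ t) := by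
    intro t
    -- The complement of the closed triangle gives the open half-line; points are null, so the
    -- closed one has the same integral.
    rw [integral_Iic_eq_integral_Iio, ← b.flip_apply _ (g₂ t),
      ← ContinuousLinearMap.integral_comp_comm _ h₁.integrableOn,
      ← integral_indicator measurableSet_Iio]
    congr 1
    ext s
    by_cases h : s < t <;> simp [indicator, hS, h, not_le]
  have i1 := hint.indicator hSm
  have i2 := hint.indicator hSm.compl
  refine ⟨?_, ?_, ?_⟩
  · exact i1.integral_prod_left.congr (.of_forall e1)
  · exact i2.integral_prod_right.congr (.of_forall e2)
  · rw [← integral_congr_ae (.of_forall e1), ← integral_congr_ae (.of_forall e2),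
      ← integral_prod _ i1, ← integral_prod_symm _ i2, ← integral_add i1 i2]
    have : ∀ q, S.indicator (fun q : ℝ × ℝ => b (g₁ q.1) (g₂ q.2)) q
        + Sᶜ.indicator (fun q : ℝ × ℝ => b (g₁ q.1) (g₂ q.2)) q = b (g₁ q.1) (g₂ q.2) :=
      fun q => congrFun (indicator_self_add_compl S _) q
    simp_rw [this]
    rw [integral_prod _ hint]
    have : ∀ s, ∫ t, b (g₁ s) (g₂ t) ∂μ = b.flip (∫ t, g₂ t ∂μ) (g₁ s) := fun s =>
      ContinuousLinearMap.integral_comp_comm _ h₂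
    simp_rw [this]
    rw [ContinuousLinearMap.integral_comp_comm _ h₁]
    rfl

/-- `u` is a primitive of `g` with respect to `μ`. -/
def IsPrimitive (μ : Measure ℝ) (u g : ℝ → E) : Prop :=
  Integrable g μ ∧ ∃ c, ∀ t, u t = c + ∫ s in Iic t, g s ∂μ

/-- Expand each factor as constant plus integral. The mixed terms commute with the integral by
linearity; the product of the two integrals is the Fubini identity for μ restricted to (-∞, t]. -/
theorem IsPrimitive.bilin {μ : Measure ℝ} [SFinite μ] [NullSingletonClass μ]
    (b : B₁ →L[ℝ] B₂ →L[ℝ] E) {u₁ g₁ : ℝ → B₁} {u₂ g₂ : ℝ → B₂}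
    (h₁ : IsPrimitive μ u₁ g₁) (h₂ : IsPrimitive μ u₂ g₂) :
    IsPrimitive μ (fun t => b (u₁ t) (u₂ t)) (fun t => b (g₁ t) (u₂ t) + b (u₁ t) (g₂ t)) := by
  obtain ⟨i₁, c₁, hu₁⟩ := h₁
  obtain ⟨i₂, c₂, hu₂⟩ := h₂
  obtain ⟨j₁, j₂, -⟩ := bilin_integral_eq_integral_primitive μ b i₁ i₂
  have k₁ : Integrable (fun t => b (g₁ t) c₂) μ := (b.flip c₂).integrable_comp i₁
  have k₂ : Integrable (fun t => b c₁ (g₂ t)) μ := (b c₁).integrable_comp i₂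
  have eq : (fun t => b (g₁ t) (u₂ t) + b (u₁ t) (g₂ t)) = fun t =>
      (b (g₁ t) c₂ + b c₁ (g₂ t)) + (b (g₁ t) (∫ s in Iic t, g₂ s ∂μ)
        + b (∫ s in Iic t, g₁ s ∂μ) (g₂ t)) := by
    ext t
    simp only [hu₁, hu₂, map_add, add_apply]
    abel
  refine ⟨by rw [eq]; exact (k₁.add k₂).add (j₁.add j₂), b c₁ c₂, fun t => ?_⟩
  obtain ⟨-, -, h⟩ := bilin_integral_eq_integral_primitive (μ.restrict (Iic t)) b
    i₁.restrict i₂.restrict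
  -- For s ≤ t the restriction to (-∞, t] is absorbed by the inner one, so the primitives for the
  -- restricted measure are the original ones.
  have r₁ : ∀ s ∈ Iic t, (μ.restrict (Iic t)).restrict (Iic s) = μ.restrict (Iic s) := by
    intro s hs
    rw [Measure.restrict_restrict measurableSet_Iic, inter_eq_left.2 (Iic_subset_Iic.2 hs)]
  have e₁ : ∫ s in Iic t, b (g₁ s) (∫ t' in Iic s, g₂ t' ∂(μ.restrict (Iic t))) ∂μ
      = ∫ s in Iic t, b (g₁ s) (∫ t' in Iic s, g₂ t' ∂μ) ∂μ :=
    setIntegral_congr_fun measurableSet_Iic fun s hs => by simp only [r₁ s hs]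
  have e₂ : ∫ s in Iic t, b (∫ t' in Iic s, g₁ t' ∂(μ.restrict (Iic t))) (g₂ s) ∂μ
      = ∫ s in Iic t, b (∫ t' in Iic s, g₁ t' ∂μ) (g₂ s) ∂μ :=
    setIntegral_congr_fun measurableSet_Iic fun s hs => by simp only [r₁ s hs]
  rw [e₁, e₂] at h
  have eq' : ∫ s in Iic t, (b (g₁ s) (u₂ s) + b (u₁ s) (g₂ s)) ∂μ
      = ∫ s in Iic t, ((b (g₁ s) c₂ + b c₁ (g₂ s)) + (b (g₁ s) (∫ s in Iic s, g₂ s ∂μ)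
        + b (∫ s in Iic s, g₁ s ∂μ) (g₂ s))) ∂μ := by rw [eq]
  have k₁₂ : Integrable (fun t => b (g₁ t) c₂ + b c₁ (g₂ t)) μ := k₁.add k₂
  have j₁₂ : Integrable (fun t => b (g₁ t) (∫ s in Iic t, g₂ s ∂μ)
    + b (∫ s in Iic t, g₁ s ∂μ) (g₂ t)) μ := j₁.add j₂
  beta_reduce
  rw [eq', integral_add k₁₂.restrict j₁₂.restrict,
    integral_add k₁.restrict k₂.restrict, integral_add j₁.restrict j₂.restrict, ← h]
  have f₁ : ∫ s in Iic t, b (g₁ s) c₂ ∂μ = b (∫ s in Iic t, g₁ s ∂μ) c₂ :=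
    (b.flip c₂).integral_comp_comm i₁.restrict
  have f₂ : ∫ s in Iic t, b c₁ (g₂ s) ∂μ = b c₁ (∫ s in Iic t, g₂ s ∂μ) :=
    (b c₁).integral_comp_comm i₂.restrict
  rw [f₁, f₂]
  simp only [hu₁, hu₂, map_add, add_apply]
  abel

variable {T : ℝ}

theorem IsTimeTest.eq_zero {φ : ℝ → ℝ} (hφ : IsTimeTest T φ) {t : ℝ} (ht : t ∉ Ioo 0 T) :
    φ t = 0 := image_eq_zero_of_notMem_tsupport fun h => ht (hφ.2.2 h)

theorem IsTimeTest.continuous_deriv {φ : ℝ → ℝ} (hφ : IsTimeTest T φ) : Continuous (deriv φ) :=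
  hφ.1.continuous_deriv (by simp)

theorem IsTimeTest.integrable_deriv {φ : ℝ → ℝ} (hφ : IsTimeTest T φ) :
    Integrable (deriv φ) := hφ.continuous_deriv.integrable_of_hasCompactSupport hφ.2.1.deriv

/-- φ vanishes at -∞ and φ' vanishes off (0,T), so cutting the measure down to (0,T) does not alter
the fundamental theorem of calculus. -/
theorem IsTimeTest.setIntegral_Iic_deriv {φ : ℝ → ℝ} (hφ : IsTimeTest T φ) (t : ℝ) :
    ∫ s in Iic t, deriv φ s ∂(volume.restrict (Ioo 0 T)) = φ t := by
  have h0 : ∀ s ∉ Ioo 0 T, deriv φ s = 0 := fun s hs =>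
    image_eq_zero_of_notMem_tsupport fun h => hs (hφ.2.2 (closure_mono (support_deriv_subset)  h
      |> fun h => by simpa [tsupport] using h))
  rw [Measure.restrict_restrict measurableSet_Iic, inter_comm,
    ← Measure.restrict_restrict measurableSet_Ioo,
    setIntegral_eq_integral_of_forall_compl_eq_zero h0,
    integral_Iic_of_hasDerivAt_of_tendsto' (m := 0)
      (fun x _ => (hφ.1.differentiable (by simp) x).hasDerivAt)
      hφ.integrable_deriv.integrableOn]
  · simp
  · exact (hφ.2.1.is_zero_at_infty).mono_left (atBot_le_cocompact)

theorem IsTimeTest.isPrimitive {φ : ℝ → ℝ} (hφ : IsTimeTest T φ) :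
    IsPrimitive (volume.restrict (Ioo 0 T)) φ (deriv φ) :=
  ⟨hφ.integrable_deriv.restrict, 0, fun t => by rw [hφ.setIntegral_Iic_deriv, zero_add]⟩

/-- A primitive has its integrand as a weak derivative. -/
theorem IsPrimitive.weak_deriv {u g : ℝ → E}
    (h : IsPrimitive (volume.restrict (Ioo 0 T)) u g) {φ : ℝ → ℝ} (hφ : IsTimeTest T φ) :
    Integrable (fun t => deriv φ t • u t) (volume.restrict (Ioo 0 T)) ∧
    Integrable (fun t => φ t • g t) (volume.restrict (Ioo 0 T)) ∧
    ∫ t in Ioo 0 T, deriv φ t • u t = - ∫ t in Ioo 0 T, φ t • g t := by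
  have hc := hφ.1.continuous
  have i2 : Integrable (fun t => φ t • g t) (volume.restrict (Ioo 0 T)) := by
    obtain ⟨C, hC⟩ := hφ.2.1.exists_bound_of_continuous hc
    exact h.1.bdd_smul C hc.aestronglyMeasurable (.of_forall hC)
  obtain ⟨i, c, hp⟩ := hφ.isPrimitive.bilin (ContinuousLinearMap.lsmul ℝ ℝ) h
  simp only [ContinuousLinearMap.lsmul_apply] at i hp
  have i1 : Integrable (fun t => deriv φ t • u t) (volume.restrict (Ioo 0 T)) :=
    (i.sub i2).congr (.of_forall fun t => by simp)
  refine ⟨i1, i2, ?_⟩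
  -- φu is a primitive that vanishes at both ends: its value at 0 shows that the constant is zero,
  -- and its value at T that the total integral is zero.
  have hl := hp 0
  have hr := hp T
  rw [hφ.eq_zero (by simp)] at hl hr
  rw [Measure.restrict_restrict measurableSet_Iic] at hl hr
  rw [show Iic (0:ℝ) ∩ Ioo 0 T = ∅ by ext; simp; intros; linarith] at hl
  rw [show Iic T ∩ Ioo 0 T = Ioo 0 T from inter_eq_right.2 fun x hx => hx.2.le] at hr
  simp only [Measure.restrict_empty, integral_zero_measure, add_zero, zero_smul] at hl
  rw [← hl, zero_add, zero_smul, integral_add i1 i2] at hr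
  exact eq_neg_of_add_eq_zero_left hr.symm

/-- The lemma of du Bois-Reymond: a function with vanishing weak derivative is constant. -/
theorem ae_eq_const_of_weak_deriv_eq_zero {u : ℝ → E}
    (hu : Integrable u (volume.restrict (Ioo 0 T)))
    (h : ∀ φ, IsTimeTest T φ → ∫ t in Ioo 0 T, deriv φ t • u t = 0) :
    ∃ c, ∀ᵐ t ∂(volume.restrict (Ioo 0 T)), u t = c := by
  rcases le_or_gt T 0 with hT | hT
  · exact ⟨0, by simp [Ioo_eq_empty_of_le hT]⟩
  -- A bump ψ of unit mass supported in [T/4, 3T/4]; the constant sought is the ψ-weighted mean of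
  -- u.
  let β : ContDiffBump (T / 2) := ⟨T / 8, T / 4, by linarith, by linarith⟩
  set ψ : ℝ → ℝ := β.normed volume with hψ
  have hψs : ContDiff ℝ ∞ ψ := β.contDiff_normed
  have hψc : HasCompactSupport ψ := β.hasCompactSupport_normed
  have hψ1 : ∫ t, ψ t = 1 := β.integral_normed
  have hψT : tsupport ψ ⊆ Ioo 0 T := by
    rw [hψ, β.tsupport_normed_eq, Real.closedBall_eq_Icc]
    exact Icc_subset_Ioo (by simp only [β]; linarith) (by simp only [β]; linarith)
  have hψi : Integrable ψ := hψs.continuous.integrable_of_hasCompactSupport hψc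
  have hsm : ∀ φ : ℝ → ℝ, IsTimeTest T φ →
      Integrable (fun t => φ t • u t) (volume.restrict (Ioo 0 T)) := by
    intro φ hφ
    obtain ⟨C, hC⟩ := hφ.2.1.exists_bound_of_continuous hφ.1.continuous
    exact hu.bdd_smul C hφ.1.continuous.aestronglyMeasurable (.of_forall hC)
  set c := ∫ t in Ioo 0 T, ψ t • u t with hc
  refine ⟨c, ?_⟩
  have key : ∀ᵐ t, t ∈ Ioo 0 T → u t - c = 0 := by
    refine isOpen_Ioo.ae_eq_zero_of_integral_contDiff_smul_eq_zero ?_ ?_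
    · exact IntegrableOn.locallyIntegrableOn (hu.sub (integrable_const c))
    · intro φ h1 h2 h3
      have hφi : Integrable φ := h1.continuous.integrable_of_hasCompactSupport h2
      set m := ∫ t, φ t with hm
      -- Removing the mass of φ leaves a function of mean zero, whose primitive Φ is again a test
      -- function; inserting Φ in `h` gives ∫ φu = m c.
      set η : ℝ → ℝ := fun t => φ t - m * ψ t with hη
      have hηs : ContDiff ℝ ∞ η := h1.sub (contDiff_const.mul hψs)
      have hηi : ∫ t, η t = 0 := by
        rw [integral_sub hφi (hψi.const_mul m), integral_const_mul, hψ1, mul_one, sub_self]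
      obtain ⟨a, b, ha, hb, hab⟩ : ∃ a b, 0 < a ∧ b < T ∧ tsupport φ ∪ tsupport ψ ⊆ Icc a b := by
        have hK : IsCompact (tsupport φ ∪ tsupport ψ) := h2.isCompact.union hψc.isCompact
        have hne : (tsupport φ ∪ tsupport ψ).Nonempty := by
          rw [union_nonempty]
          right
          by_contra h0
          rw [not_nonempty_iff_eq_empty, tsupport_eq_empty_iff] at h0
          simp [h0] at hψ1
        have hsub := union_subset h3 hψT
        exact ⟨_, _, (hsub (hK.sInf_mem hne)).1, (hsub (hK.sSup_mem hne)).2, fun x hx =>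
          ⟨csInf_le hK.bddBelow hx, le_csSup hK.bddAbove hx⟩⟩
      have hη0 : ∀ t ∉ Icc a b, η t = 0 := by
        intro t ht
        have h1 : φ t = 0 := image_eq_zero_of_notMem_tsupport fun h => ht (hab (.inl h))
        have h2 : ψ t = 0 := image_eq_zero_of_notMem_tsupport fun h => ht (hab (.inr h))
        simp [hη, h1, h2]
      set Φ : ℝ → ℝ := fun t => ∫ s in (0:ℝ)..t, η s with hΦ
      have hΦd : ∀ t, HasDerivAt Φ (η t) t := fun t =>
        intervalIntegral.integral_hasDerivAt_right (hηs.continuous.intervalIntegrable _ _)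
          hηs.continuous.stronglyMeasurable.stronglyMeasurableAtFilter hηs.continuous.continuousAt
      have hΦ' : deriv Φ = η := funext fun t => (hΦd t).deriv
      have hΦs : tsupport Φ ⊆ Icc a b := by
        refine closure_minimal (fun t ht => ?_) isClosed_Icc
        by_contra h0
        refine ht ?_
        -- Left of a the integrand vanishes on the whole interval; right of b the integral is the
        -- full mass of η, which is zero.
        rcases not_and_or.1 h0 with h0 | h0
        · simp only [hΦ]
          rw [intervalIntegral.integral_congr (g := fun _ => 0)]
          · simp
          · intro s hs
            refine hη0 s fun hs' => ?_
            rcases le_total 0 t with h | h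
            · rw [uIcc_of_le h] at hs
              exact h0 (hs'.1.trans hs.2)
            · rw [uIcc_of_ge h] at hs
              linarith [hs'.1, hs.2]
        · simp only [hΦ]
          rw [intervalIntegral.integral_eq_integral_of_support_subset, hηi]
          intro s hs
          by_contra h1
          refine hs (hη0 s fun hs' => h1 ⟨by linarith [hs'.1], ?_⟩)
          linarith [hs'.2]
      have hΦt : IsTimeTest T Φ := by
        refine ⟨?_, HasCompactSupport.of_support_subset_isCompact isCompact_Icc
          ((subset_tsupport _).trans hΦs), hΦs.trans (Icc_subset_Ioo ha hb)⟩
        rw [contDiff_infty_iff_deriv, hΦ']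
        exact ⟨fun t => (hΦd t).differentiableAt, hηs⟩
      have hz := h Φ hΦt
      rw [hΦ'] at hz
      have i1 := hsm φ ⟨h1, h2, h3⟩
      have i2 := hsm ψ ⟨hψs, hψc, hψT⟩
      simp only [hη, sub_smul, mul_smul] at hz
      have i3 : Integrable (fun t => φ t • c) (volume.restrict (Ioo 0 T)) :=
        hφi.restrict.smul_const c
      have e0 : ∀ t ∉ Ioo 0 T, φ t • (u t - c) = 0 := fun t ht => by
        rw [IsTimeTest.eq_zero ⟨h1, h2, h3⟩ ht, zero_smul]
      rw [← setIntegral_eq_integral_of_forall_compl_eq_zero e0]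
      simp only [smul_sub]
      rw [integral_sub i1 i3, integral_smul_const,
        setIntegral_eq_integral_of_forall_compl_eq_zero
          (fun t ht => IsTimeTest.eq_zero ⟨h1, h2, h3⟩ ht)]
      have i4 : Integrable (fun t => m • ψ t • u t) (volume.restrict (Ioo 0 T)) := i2.smul m
      rw [integral_sub i1 i4, integral_smul] at hz
      exact hz
  filter_upwards [ae_restrict_of_ae key, ae_restrict_mem measurableSet_Ioo] with t h1 h2
  exact sub_eq_zero.1 (h1 h2)

/-- An element of `H¹(0,T;E)` is almost everywhere the primitive of its weak derivative. -/
theorem H1Bochner.exists_isPrimitive (y : H1Bochner T E) :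
    ∃ u, IsPrimitive (volume.restrict (Ioo 0 T)) u y.dt ∧
      u =ᵐ[volume.restrict (Ioo 0 T)] y.val := by
  have ig := y.integrable_dt
  have iv := y.integrable_val
  set U : ℝ → E := fun t => 0 + ∫ s in Iic t, y.dt s ∂(volume.restrict (Ioo 0 T))
  have hU : IsPrimitive (volume.restrict (Ioo 0 T)) U y.dt := ⟨ig, 0, fun t => rfl⟩
  have hUi : Integrable U (volume.restrict (Ioo 0 T)) := by
    -- With the constant 1 as second integrand, the Fubini lemma yields integrability of the
    -- primitive.
    obtain ⟨-, h, -⟩ := bilin_integral_eq_integral_primitive (volume.restrict (Ioo 0 T))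
      (ContinuousLinearMap.lsmul ℝ ℝ).flip ig (integrable_const (1:ℝ))
    simpa [U] using h
  obtain ⟨c, hc⟩ := ae_eq_const_of_weak_deriv_eq_zero (u := fun t => y.val t - U t)
    (iv.sub hUi) (fun φ hφ => by
      obtain ⟨i1, -, h⟩ := hU.weak_deriv hφ
      obtain ⟨C, hC⟩ := hφ.2.1.deriv.exists_bound_of_continuous hφ.continuous_deriv
      have i2 : Integrable (fun t => deriv φ t • y.val t) (volume.restrict (Ioo 0 T)) :=
        iv.bdd_smul C hφ.continuous_deriv.aestronglyMeasurable (.of_forall hC)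
      simp only [smul_sub]
      rw [integral_sub i2 i1, h, y.weak_deriv φ hφ, sub_self])
  refine ⟨fun t => c + U t, ⟨ig, c, fun t => by simp [U]⟩, ?_⟩
  filter_upwards [hc] with t ht
  rw [← ht]
  abel

/-- The product rule in Bochner-Sobolev spaces. -/
theorem H1Bochner.weak_deriv_bilin (y : H1Bochner T B₁) (b : B₁ →L[ℝ] B₁ →L[ℝ] E)
    {φ : ℝ → ℝ} (hφ : IsTimeTest T φ) :
    Integrable (fun t => deriv φ t • b (y.val t) (y.val t)) (volume.restrict (Ioo 0 T)) ∧
    Integrable (fun t => φ t • (b (y.dt t) (y.val t) + b (y.val t) (y.dt t)))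
      (volume.restrict (Ioo 0 T)) ∧
    ∫ t in Ioo 0 T, deriv φ t • b (y.val t) (y.val t) =
      - ∫ t in Ioo 0 T, φ t • (b (y.dt t) (y.val t) + b (y.val t) (y.dt t)) := by
  obtain ⟨u, hu, huy⟩ := y.exists_isPrimitive
  obtain ⟨i1, i2, h⟩ := (hu.bilin b hu).weak_deriv hφ
  have e1 : (fun t => deriv φ t • b (u t) (u t)) =ᵐ[volume.restrict (Ioo 0 T)]
      fun t => deriv φ t • b (y.val t) (y.val t) := huy.mono fun t ht => by simp only [ht]
  have e2 : (fun t => φ t • (b (y.dt t) (u t) + b (u t) (y.dt t))) =ᵐ[volume.restrict (Ioo 0 T)]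
      fun t => φ t • (b (y.dt t) (y.val t) + b (y.val t) (y.dt t)) :=
    huy.mono fun t ht => by simp only [ht]
  exact ⟨i1.congr e1, i2.congr e2, by rw [← integral_congr_ae e1, h, integral_congr_ae e2]⟩

/-- The product of a bounded element of `H¹(0,T;B)` with itself under a bilinear map. -/
noncomputable def H1Bochner.bilinSelf (y : H1Bochner T B₁) (b : B₁ →L[ℝ] B₁ →L[ℝ] E) {R : ℝ}
    (hR : ∀ᵐ t ∂(volume.restrict (Ioo 0 T)), ‖y.val t‖ ≤ R) : H1Bochner T E where
  val t := b (y.val t) (y.val t)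
  dt t := b (y.dt t) (y.val t) + b (y.val t) (y.dt t)
  -- Boundedness in time is what makes this L^∞ · L² ⊂ L²; two L² factors alone would only give L¹.
  memLp_val := b.memLp_of_bilin 2 (memLp_top_of_bound y.memLp_val.1 R hR) y.memLp_val
  memLp_dt := (b.memLp_of_bilin 2 y.memLp_dt (memLp_top_of_bound y.memLp_val.1 R hR)).add
    (b.memLp_of_bilin 2 (memLp_top_of_bound y.memLp_val.1 R hR) y.memLp_dt)
  weak_deriv _ hφ := (y.weak_deriv_bilin b hφ).2.2

/-- The product rule for a symmetric bilinear form. -/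
theorem H1Bochner.integral_symm_bilin (y : H1Bochner T B₁) (b : B₁ →L[ℝ] B₁ →L[ℝ] ℝ)
    (hb : ∀ u w, b u w = b w u) {φ : ℝ → ℝ} (hφ : IsTimeTest T φ) :
    IntegrableOn (fun t => -(φ t * b (y.dt t) (y.val t) +
      1 / 2 * (deriv φ t * b (y.val t) (y.val t)))) (Ioo 0 T) ∧
    ∫ t in Ioo 0 T, -(φ t * b (y.dt t) (y.val t) +
      1 / 2 * (deriv φ t * b (y.val t) (y.val t))) = 0 := by
  obtain ⟨i1, i2, h⟩ := y.weak_deriv_bilin b hφ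
  have e : (fun t => -(φ t * b (y.dt t) (y.val t) + 1 / 2 * (deriv φ t * b (y.val t) (y.val t)))) =
      fun t => (-1 / 2 : ℝ) * (deriv φ t • b (y.val t) (y.val t) +
        φ t • (b (y.dt t) (y.val t) + b (y.val t) (y.dt t))) := by
    ext t
    rw [hb (y.val t) (y.dt t), smul_eq_mul, smul_eq_mul]
    ring
  rw [e]
  refine ⟨(i1.add i2).const_mul (-1 / 2), ?_⟩
  rw [integral_const_mul, integral_add i1 i2, h, neg_add_cancel, mul_zero]

end Time

/-! ### Morrey's L^∞ bound by averaging over rays. -/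

section Morrey

variable {n : ℕ}

theorem norm_gradient (φ : Euc n → ℝ) (x : Euc n) : ‖gradient φ x‖ = ‖fderiv ℝ φ x‖ := by
  simp [gradient]

/-- A compactly supported function is controlled by its gradient along a ray. -/
theorem enorm_le_lintegral_ray {φ : Euc n → ℝ} (hφ : ContDiff ℝ ∞ φ) {R : ℝ} (hR : 0 < R)
    (hs : tsupport φ ⊆ Metric.ball 0 R) (x : Euc n) {w : Euc n} (hw : 1 ≤ ‖w‖) (hw' : ‖w‖ ≤ 3) :
    ‖φ x‖ₑ ≤ 3 * ∫⁻ s in Ioc 0 (2 * R), ‖fderiv ℝ φ (x + s • w)‖ₑ := by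
  by_cases hx : x ∈ tsupport φ
  swap
  · simp [image_eq_zero_of_notMem_tsupport hx]
  have hx' : ‖x‖ < R := by simpa using hs hx
  have hd : ∀ s : ℝ, HasDerivAt (fun s : ℝ => φ (x + s • w)) (fderiv ℝ φ (x + s • w) w) s := by
    intro s
    have h1 : HasDerivAt (fun s : ℝ => x + s • w) w s := by
      simpa using ((hasDerivAt_id s).smul_const w).const_add x
    exact ((hφ.differentiable (by simp)) (x + s • w)).hasFDerivAt.comp_hasDerivAt s h1
  have hcf : Continuous (fderiv ℝ φ) := hφ.continuous_fderiv (by simp)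
  have hc : Continuous (fun s : ℝ => fderiv ℝ φ (x + s • w) w) := by fun_prop
  -- As ‖w‖ ≥ 1, by parameter 2R the ray from a point of the ball of radius R has left that ball.
  have hend : φ (x + (2 * R) • w) = 0 := by
    refine image_eq_zero_of_notMem_tsupport fun h => ?_
    have h1 : ‖x + (2 * R) • w‖ < R := by simpa using hs h
    have h2 : ‖(2 * R) • w‖ ≤ ‖x + (2 * R) • w‖ + ‖x‖ := by
      simpa using norm_sub_le (x + (2 * R) • w) x
    rw [norm_smul, Real.norm_of_nonneg (by positivity)] at h2
    nlinarith
  have hftc := intervalIntegral.integral_eq_sub_of_hasDerivAt (a := 0) (b := 2 * R)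
    (fun s _ => hd s) (hc.intervalIntegrable _ _)
  rw [hend, zero_smul, add_zero, zero_sub, intervalIntegral.integral_of_le (by positivity)] at hftc
  rw [← enorm_neg, ← hftc, ← lintegral_const_mul _ (by fun_prop)]
  refine (enorm_integral_le_lintegral_enorm _).trans (lintegral_mono fun s => ?_)
  rw [mul_comm]
  refine (ContinuousLinearMap.le_opENorm _ _).trans ?_
  gcongr
  rw [← ofReal_norm]
  exact (ENNReal.ofReal_le_ofReal hw').trans (by simp)

/-- The Jacobian s^{-n} is the source of the condition r > n: its r-th root must be integrable in s
near 0. -/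
theorem lintegral_comp_add_smul (F : Euc n → ℝ≥0∞) (hF : Measurable F) (x : Euc n) {s : ℝ}
    (hs : 0 < s) : ∫⁻ w, F (x + s • w) = ENNReal.ofReal ((s ^ n)⁻¹) * ∫⁻ z, F z := by
  have h1 : ∫⁻ w, F (x + s • w) = ∫⁻ z, F (x + z) ∂(Measure.map (s • ·) volume) :=
    (lintegral_map (hF.comp (measurable_const_add x)) (measurable_const_smul s)).symm
  rw [h1, Measure.map_addHaar_smul _ hs.ne', lintegral_smul_measure, lintegral_add_left_eq_self]
  simp [abs_of_pos hs]

/-- **Morrey's inequality**, as an `L^∞` bound for compactly supported functions. -/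
theorem exists_enorm_le_eLpNorm_gradient (hn : 1 ≤ n) {r : ℝ} (hr : 1 ≤ r) (hrn : (n : ℝ) < r)
    {Ω : Set (Euc n)} (hΩ : Bornology.IsBounded Ω) :
    ∃ C : ℝ≥0, ∀ φ : Euc n → ℝ, ContDiff ℝ ∞ φ → tsupport φ ⊆ Ω → ∀ x,
      ‖φ x‖ₑ ≤ C * eLpNorm (gradient φ) (ENNReal.ofReal r) (volume.restrict Ω) := by
  obtain ⟨R, hR, hΩR⟩ : ∃ R > 0, Ω ⊆ Metric.ball (0 : Euc n) R := by
    obtain ⟨R, hR⟩ := hΩ.subset_ball 0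
    exact ⟨max R 1, by positivity, hR.trans (Metric.ball_subset_ball (le_max_left _ _))⟩
  have hr0 : 0 < r := by linarith
  have : Nonempty (Fin n) := ⟨⟨0, hn⟩⟩
  -- The ray bound is averaged over the unit ball about a vector of norm 2, where 1 ≤ ‖w‖ ≤ 3.
  obtain ⟨e, he⟩ : ∃ e : Euc n, ‖e‖ = 2 := exists_norm_eq (Euc n) (by norm_num)
  set A : Set (Euc n) := Metric.ball e 1 with hA
  have hA1 : ∀ w ∈ A, 1 ≤ ‖w‖ ∧ ‖w‖ ≤ 3 := by
    intro w hw
    rw [hA, mem_ball_iff_norm] at hw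
    constructor
    · have := norm_sub_norm_le e w
      rw [norm_sub_rev] at this
      linarith
    · have := norm_sub_norm_le w e
      linarith
  have hA0 : volume A ≠ 0 := (Metric.measure_ball_pos _ _ one_pos).ne'
  have hAt : volume A ≠ ⊤ := measure_ball_lt_top.ne
  set I : ℝ≥0∞ := ∫⁻ s in Ioc 0 (2 * R), ENNReal.ofReal (s ^ (-(n / r) : ℝ)) with hI
  have hIt : I ≠ ⊤ := by
    have h1 : IntegrableOn (fun s : ℝ => s ^ (-(n / r) : ℝ)) (Ioc 0 (2 * R)) := by
      rw [← intervalIntegrable_iff_integrableOn_Ioc_of_le (by positivity)]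
      exact intervalIntegral.intervalIntegrable_rpow' (by
        rw [neg_lt_neg_iff, div_lt_one hr0]; exact hrn)
    exact h1.lintegral_lt_top.ne
  set D : ℝ≥0∞ := (volume A)⁻¹ * (3 * (volume A ^ (1 - 1 / r) * I)) with hD
  have hDt : D ≠ ⊤ := by
    refine ENNReal.mul_ne_top (ENNReal.inv_ne_top.2 hA0) (ENNReal.mul_ne_top (by simp)
      (ENNReal.mul_ne_top (ENNReal.rpow_ne_top_of_nonneg ?_ hAt) hIt))
    rw [sub_nonneg, div_le_one hr0]; exact hr
  refine ⟨D.toNNReal, fun φ hφ hs x => ?_⟩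
  rw [ENNReal.coe_toNNReal hDt]
  have hcf : Continuous (fderiv ℝ φ) := hφ.continuous_fderiv (by simp)
  set N : ℝ≥0∞ := (∫⁻ z, ‖fderiv ℝ φ z‖ₑ ^ r) ^ (1 / r) with hN
  have hNeq : eLpNorm (gradient φ) (ENNReal.ofReal r) (volume.restrict Ω) = N := by
    rw [eLpNorm_restrict_eq_of_support_subset]
    · rw [eLpNorm_eq_lintegral_rpow_enorm_toReal (by simpa using hr0) (by simp),
        ENNReal.toReal_ofReal hr0.le, hN]
      congr 2
      ext z
      rw [← ofReal_norm, norm_gradient, ofReal_norm]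
    · intro z hz
      refine hs (support_fderiv_subset ℝ fun h => hz ?_)
      simp [gradient, h]
  rw [hNeq]
  -- Hölder on A passes from L¹ to L^r at the cost of |A|^{1-1/r}; scaling then yields s^{-n/r}
  -- times the full gradient norm.
  have hslice : ∀ s ∈ Ioc 0 (2 * R), ∫⁻ w in A, ‖fderiv ℝ φ (x + s • w)‖ₑ
      ≤ volume A ^ (1 - 1 / r) * (ENNReal.ofReal (s ^ (-(n / r) : ℝ)) * N) := by
    intro s hs
    have hc : Continuous (fun w : Euc n => fderiv ℝ φ (x + s • w)) := by fun_prop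
    have h1 := eLpNorm_le_eLpNorm_mul_rpow_measure_univ (μ := volume.restrict A) (p := 1)
      (q := ENNReal.ofReal r) (by simpa using hr) hc.aestronglyMeasurable
    rw [eLpNorm_one_eq_lintegral_enorm, Measure.restrict_apply_univ, ENNReal.toReal_one,
      ENNReal.toReal_ofReal hr0.le, mul_comm, div_one] at h1
    refine h1.trans ?_
    gcongr
    rw [eLpNorm_eq_lintegral_rpow_enorm_toReal (by simpa using hr0) (by simp),
        ENNReal.toReal_ofReal hr0.le]
    calc (∫⁻ w in A, ‖fderiv ℝ φ (x + s • w)‖ₑ ^ r) ^ (1 / r)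
        ≤ (∫⁻ w, ‖fderiv ℝ φ (x + s • w)‖ₑ ^ r) ^ (1 / r) := by
          gcongr
          exact Measure.restrict_le_self
      _ = _ := by
          rw [lintegral_comp_add_smul (fun z => ‖fderiv ℝ φ z‖ₑ ^ r) (by fun_prop) x hs.1,
            ENNReal.mul_rpow_of_nonneg _ _ (by positivity), hN,
            ENNReal.ofReal_rpow_of_nonneg (by have := hs.1; positivity) (by positivity)]
          congr 2
          rw [← Real.rpow_natCast, ← Real.rpow_neg hs.1.le, ← Real.rpow_mul hs.1.le]
          congr 1
          ring
  have hmain : ‖φ x‖ₑ * volume A ≤ 3 * (volume A ^ (1 - 1 / r) * (I * N)) := by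
    have hcm : Continuous (fun q : Euc n × ℝ => ‖fderiv ℝ φ (x + q.2 • q.1)‖ₑ) := by fun_prop
    calc ‖φ x‖ₑ * volume A = ∫⁻ w in A, ‖φ x‖ₑ := by simp
      _ ≤ ∫⁻ w in A, 3 * ∫⁻ s in Ioc 0 (2 * R), ‖fderiv ℝ φ (x + s • w)‖ₑ :=
          setLIntegral_mono' measurableSet_ball fun w hw =>
            enorm_le_lintegral_ray hφ hR (hs.trans hΩR) x (hA1 w hw).1 (hA1 w hw).2
      _ = 3 * ∫⁻ s in Ioc 0 (2 * R), ∫⁻ w in A, ‖fderiv ℝ φ (x + s • w)‖ₑ := by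
          rw [lintegral_const_mul' _ _ (by simp), lintegral_lintegral_swap]
          exact hcm.measurable.aemeasurable
      _ ≤ 3 * ∫⁻ s in Ioc 0 (2 * R),
            volume A ^ (1 - 1 / r) * (ENNReal.ofReal (s ^ (-(n / r) : ℝ)) * N) := by
          gcongr 3 * ?_
          exact setLIntegral_mono' measurableSet_Ioc hslice
      _ = _ := by
          rw [lintegral_const_mul _ (by fun_prop), lintegral_mul_const _ (by fun_prop)]
  rw [← ENNReal.mul_le_mul_iff_left hA0 hAt]
  refine hmain.trans (le_of_eq ?_)
  have : (volume A)⁻¹ * volume A = 1 := ENNReal.inv_mul_cancel hA0 hAt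
  calc 3 * (volume A ^ (1 - 1 / r) * (I * N))
      = ((volume A)⁻¹ * volume A) * (3 * (volume A ^ (1 - 1 / r) * (I * N))) := by
        rw [this, one_mul]
    _ = _ := by rw [hD]; ring

end Morrey

/-- `φ ∈ C_c^∞(Ω)`. -/
def IsSpaceTest {n : ℕ} (Ω : Set (Euc n)) (φ : Euc n → ℝ) : Prop :=
  ContDiff ℝ ∞ φ ∧ HasCompactSupport φ ∧ tsupport φ ⊆ Ω

/-! ### Building bounded bilinear maps. -/

section Bilinear

variable {V X Y : Type*} [NormedAddCommGroup V] [NormedSpace ℝ V] [NormedAddCommGroup X]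
  [NormedSpace ℝ X] [NormedAddCommGroup Y] [NormedSpace ℝ Y]

/-- The bilinear map with given components. -/
def bilinProd (B₁ : V →L[ℝ] V →L[ℝ] X) (B₂ : V →L[ℝ] V →L[ℝ] Y) : V →L[ℝ] V →L[ℝ] X × Y :=
  (ContinuousLinearMap.compL ℝ V X (X × Y) (ContinuousLinearMap.inl ℝ X Y)).comp B₁ +
    (ContinuousLinearMap.compL ℝ V Y (X × Y) (ContinuousLinearMap.inr ℝ X Y)).comp B₂

theorem bilinProd_apply (B₁ : V →L[ℝ] V →L[ℝ] X) (B₂ : V →L[ℝ] V →L[ℝ] Y) (u w : V) :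
    bilinProd B₁ B₂ u w = (B₁ u w, B₂ u w) := by simp [bilinProd]

/-- A bilinear map with values in a subspace. -/
def bilinCodRestrict (B : V →L[ℝ] V →L[ℝ] X) (W : Submodule ℝ X) (h : ∀ u w, B u w ∈ W) :
    V →L[ℝ] V →L[ℝ] W :=
  (LinearMap.mk₂ ℝ (fun u w => (⟨B u w, h u w⟩ : W))
    (fun _ _ _ => Subtype.ext (by simp)) (fun _ _ _ => Subtype.ext (by simp))
    (fun _ _ _ => Subtype.ext (by simp)) (fun _ _ _ => Subtype.ext (by simp))).mkContinuous₂ ‖B‖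
    fun u w => B.le_opNorm₂ u w

theorem bilin_mem_of_dense (B : V →L[ℝ] V →L[ℝ] X) {W : Submodule ℝ X}
    (hW : IsClosed (W : Set X)) {s : Set V} (hs : Dense s) (h : ∀ u ∈ s, ∀ w ∈ s, B u w ∈ W)
    (u w : V) : B u w ∈ W := by
  have := map_mem_closure₂ (f := fun u w => B u w) B.continuous₂ (hs u) (hs w) h
  rwa [hW.closure_eq] at this

/-- The pullback of the inner product. -/
def innerPullback {H : Type*} [NormedAddCommGroup H] [InnerProductSpace ℝ H] (G : V →L[ℝ] H) :
    V →L[ℝ] V →L[ℝ] ℝ := (innerSL ℝ : H →L[ℝ] H →L[ℝ] ℝ).bilinearComp G G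

theorem innerPullback_apply {H : Type*} [NormedAddCommGroup H] [InnerProductSpace ℝ H]
    (G : V →L[ℝ] H) (u w : V) : innerPullback G u w = ⟪G u, G w⟫ := rfl

end Bilinear

/-! ### W₀^{1,p}(Ω): density, inclusions and multiplication. -/

section Sobolev

variable {n : ℕ} {p : ℝ≥0∞} {Ω : Set (Euc n)}

theorem IsSpaceTest.continuous_gradient {φ : Euc n → ℝ} (h : IsSpaceTest Ω φ) :
    Continuous (gradient φ) :=
  (LinearIsometryEquiv.continuous _).comp (h.1.continuous_fderiv (by simp))

theorem IsSpaceTest.memLp {φ : Euc n → ℝ} (h : IsSpaceTest Ω φ) :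
    MemLp φ p (volume.restrict Ω) :=
  (h.1.continuous.memLp_of_hasCompactSupport h.2.1).restrict Ω

theorem IsSpaceTest.memLp_gradient {φ : Euc n → ℝ} (h : IsSpaceTest Ω φ) :
    MemLp (gradient φ) p (volume.restrict Ω) :=
  (h.continuous_gradient.memLp_of_hasCompactSupport
    ((h.2.1.fderiv (𝕜 := ℝ)).comp_left (g := (InnerProductSpace.toDual ℝ (Euc n)).symm)
      (map_zero _))).restrict Ω

theorem gradient_mul {φ ψ : Euc n → ℝ} (hφ : ContDiff ℝ ∞ φ) (hψ : ContDiff ℝ ∞ ψ) (x : Euc n) :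
    gradient (φ * ψ) x = φ x • gradient ψ x + ψ x • gradient φ x := by
  simp [gradient, fderiv_mul (hφ.differentiable (by simp) x) (hψ.differentiable (by simp) x)]

theorem IsSpaceTest.mul {φ ψ : Euc n → ℝ} (hφ : IsSpaceTest Ω φ) (hψ : IsSpaceTest Ω ψ) :
    IsSpaceTest Ω (φ * ψ) :=
  ⟨hφ.1.mul hψ.1, hφ.2.1.mul_right, (tsupport_mul_subset_left).trans hφ.2.2⟩

variable [Fact (1 ≤ p)]

instance : NormedAddCommGroup (W0 p Ω) := Submodule.normedAddCommGroup _

instance : NormedSpace ℝ (W0 p Ω) := Submodule.normedSpace _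

instance : TopologicalSpace (W0 p Ω) := UniformSpace.toTopologicalSpace

/-- A test function as an element of `W₀^{1,p}(Ω)`. -/
def IsSpaceTest.toW0 {φ : Euc n → ℝ} (p : ℝ≥0∞) [Fact (1 ≤ p)] (h : IsSpaceTest Ω φ) : W0 p Ω :=
  ⟨(h.memLp.toLp, h.memLp_gradient.toLp), subset_closure
    ⟨φ, h.1, h.2.1, h.2.2, h.memLp.coeFn_toLp, h.memLp_gradient.coeFn_toLp⟩⟩

theorem IsSpaceTest.sobFn_toW0 {φ : Euc n → ℝ} (h : IsSpaceTest Ω φ) :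
    sobFn (h.toW0 p) =ᵐ[volume.restrict Ω] φ := h.memLp.coeFn_toLp

theorem IsSpaceTest.sobGrad_toW0 {φ : Euc n → ℝ} (h : IsSpaceTest Ω φ) :
    sobGrad (h.toW0 p) =ᵐ[volume.restrict Ω] gradient φ := h.memLp_gradient.coeFn_toLp

variable (p Ω) in
/-- `u ↦ u`, from `W₀^{1,p}(Ω)` to `L^p(Ω)`. -/
def sobFnL : W0 p Ω →L[ℝ] Lp ℝ p (volume.restrict Ω) :=
  (ContinuousLinearMap.fst ℝ _ _).comp (W0 p Ω).subtypeL

variable (p Ω) in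
/-- `u ↦ ∇u`, from `W₀^{1,p}(Ω)` to `L^p(Ω)ⁿ`. -/
def sobGradL : W0 p Ω →L[ℝ] Lp (Euc n) p (volume.restrict Ω) :=
  (ContinuousLinearMap.snd ℝ _ _).comp (W0 p Ω).subtypeL

theorem coeFn_sobFnL (u : W0 p Ω) : (sobFnL p Ω u : Euc n → ℝ) = sobFn u := rfl

theorem coeFn_sobGradL (u : W0 p Ω) : (sobGradL p Ω u : Euc n → Euc n) = sobGrad u := rfl

theorem norm_sobGradL_le (u : W0 p Ω) : ‖sobGradL p Ω u‖ ≤ ‖u‖ := norm_snd_le u.1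

theorem norm_W0 (u : W0 p Ω) : ‖u‖ = max ‖sobFnL p Ω u‖ ‖sobGradL p Ω u‖ := rfl

theorem memLp_sobFn (u : W0 p Ω) : MemLp (sobFn u) p (volume.restrict Ω) := Lp.memLp _

theorem memLp_sobGrad (u : W0 p Ω) : MemLp (sobGrad u) p (volume.restrict Ω) := Lp.memLp _

theorem sobFn_add (u w : W0 p Ω) :
    sobFn (u + w) =ᵐ[volume.restrict Ω] fun x => sobFn u x + sobFn w x :=
  Lp.coeFn_add (sobFnL p Ω u) (sobFnL p Ω w)

theorem sobFn_sub (u w : W0 p Ω) :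
    sobFn (u - w) =ᵐ[volume.restrict Ω] fun x => sobFn u x - sobFn w x :=
  Lp.coeFn_sub (sobFnL p Ω u) (sobFnL p Ω w)

theorem sobFn_smul (c : ℝ) (u : W0 p Ω) :
    sobFn (c • u) =ᵐ[volume.restrict Ω] fun x => c * sobFn u x :=
  Lp.coeFn_smul c (sobFnL p Ω u)

theorem W0_ext {u w : W0 p Ω} (h1 : sobFn u =ᵐ[volume.restrict Ω] sobFn w)
    (h2 : sobGrad u =ᵐ[volume.restrict Ω] sobGrad w) : u = w :=
  Subtype.ext (Prod.ext (Lp.ext h1) (Lp.ext h2))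

theorem exists_eq_toW0_of_mem_testPairs {u : W0 p Ω} (hu : u.1 ∈ testPairs p Ω) :
    ∃ (φ : Euc n → ℝ) (h : IsSpaceTest Ω φ), u = h.toW0 p := by
  obtain ⟨φ, h1, h2, h3, h4, h5⟩ := hu
  have h : IsSpaceTest Ω φ := ⟨h1, h2, h3⟩
  exact ⟨φ, h, W0_ext (EventuallyEq.trans h4 h.sobFn_toW0.symm)
    (EventuallyEq.trans h5 h.sobGrad_toW0.symm)⟩

variable (p Ω) in
theorem dense_toW0 :
    Dense {u : W0 p Ω | ∃ (φ : Euc n → ℝ) (h : IsSpaceTest Ω φ), u = h.toW0 p} := by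
  have h : Dense {u : W0 p Ω | u.1 ∈ testPairs p Ω} := by
    intro u
    rw [closure_subtype]
    refine closure_mono ?_ u.2
    intro w hw
    exact ⟨⟨w, subset_closure hw⟩, hw, rfl⟩
  exact h.mono fun u hu => exists_eq_toW0_of_mem_testPairs hu

/-- Convergence in `W₀^{1,p}(Ω)` implies almost everywhere convergence along a subsequence. -/
theorem exists_seq_tendsto_ae_sobFn {w : ℕ → W0 p Ω} {u : W0 p Ω} (h : Tendsto w atTop (𝓝 u)) :
    ∃ ns : ℕ → ℕ, StrictMono ns ∧ ∀ᵐ x ∂(volume.restrict Ω),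
      Tendsto (fun k => sobFn (w (ns k)) x) atTop (𝓝 (sobFn u x)) :=
  (tendstoInMeasure_of_tendsto_Lp (((sobFnL p Ω).continuous.tendsto u).comp h)).exists_seq_tendsto_ae

/-- The embedding `W₀^{1,r}(Ω) ⊂ L^∞(Ω)` for `r > n`. -/
theorem exists_ae_abs_sobFn_le (hn : 1 ≤ n) {r : ℝ} [hr : Fact (2 ≤ r)] (hrn : (n : ℝ) < r)
    (hΩ : Bornology.IsBounded Ω) :
    ∃ C : ℝ, 0 ≤ C ∧ ∀ u : W0 (ENNReal.ofReal r) Ω,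
      ∀ᵐ x ∂(volume.restrict Ω), |sobFn u x| ≤ C * ‖u‖ := by
  obtain ⟨C, hC⟩ := exists_enorm_le_eLpNorm_gradient hn (by linarith [hr.out]) hrn hΩ
  refine ⟨C, C.2, fun u => ?_⟩
  obtain ⟨w, hw, hwu⟩ := mem_closure_iff_seq_limit.1 (dense_toW0 (ENNReal.ofReal r) Ω u)
  obtain ⟨ns, hns, hae⟩ := exists_seq_tendsto_ae_sobFn hwu
  -- Morrey's bound applies to the approximating test functions; almost everywhere convergence of a
  -- subsequence carries it to u.
  have hb : ∀ k, ∀ᵐ x ∂(volume.restrict Ω), |sobFn (w k) x| ≤ C * ‖w k‖ := by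
    intro k
    obtain ⟨φ, h, hk⟩ := hw k
    rw [hk]
    filter_upwards [h.sobFn_toW0 (p := ENNReal.ofReal r)] with x hx
    rw [hx]
    have h1 := hC φ h.1 h.2.2 x
    rw [← eLpNorm_congr_ae (h.sobGrad_toW0 (p := ENNReal.ofReal r)), ← coeFn_sobGradL,
      ← Lp.enorm_def] at h1
    have h2 := ENNReal.toReal_mono (ENNReal.mul_ne_top ENNReal.coe_ne_top enorm_ne_top) h1
    rw [ENNReal.toReal_mul, toReal_enorm, toReal_enorm, ENNReal.coe_toReal] at h2
    calc |φ x| ≤ C * ‖sobGradL (ENNReal.ofReal r) Ω (h.toW0 _)‖ := h2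
      _ ≤ _ := by gcongr; exact norm_sobGradL_le _
  filter_upwards [hae, ae_all_iff.2 hb] with x hx1 hx2
  refine le_of_tendsto_of_tendsto hx1.abs ?_ (.of_forall fun k => hx2 (ns k))
  exact ((hwu.comp hns.tendsto_atTop).norm).const_mul _

/-- The inclusion `L^p ⊂ L^q` for `q ≤ p` and a finite measure, as a linear map. -/
def lpInclusionₗ {α : Type*} (E : Type*) [MeasurableSpace α] (μ : Measure α) [IsFiniteMeasure μ]
    [NormedAddCommGroup E] [NormedSpace ℝ E] {p q : ℝ≥0∞} (hqp : q ≤ p) :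
    Lp E p μ →ₗ[ℝ] Lp E q μ where
  toFun u := ((Lp.memLp u).mono_exponent hqp).toLp
  map_add' u w := by
    rw [← MemLp.toLp_add]
    exact MemLp.toLp_congr _ _ (Lp.coeFn_add u w)
  map_smul' c u := by
    rw [RingHom.id_apply, ← MemLp.toLp_const_smul]
    exact MemLp.toLp_congr _ _ (Lp.coeFn_smul c u)

theorem coeFn_lpInclusionₗ {α E : Type*} [MeasurableSpace α] {μ : Measure α} [IsFiniteMeasure μ]
    [NormedAddCommGroup E] [NormedSpace ℝ E] {p q : ℝ≥0∞} (hqp : q ≤ p) (u : Lp E p μ) :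
    lpInclusionₗ E μ hqp u =ᵐ[μ] u := ((Lp.memLp u).mono_exponent hqp).coeFn_toLp

/-- The inclusion `L^p ⊂ L^q` for `q ≤ p` and a finite measure. -/
def lpInclusion {α : Type*} (E : Type*) [MeasurableSpace α] (μ : Measure α) [IsFiniteMeasure μ]
    [NormedAddCommGroup E] [NormedSpace ℝ E] {p q : ℝ≥0∞} [Fact (1 ≤ p)] [Fact (1 ≤ q)]
    (hqp : q ≤ p) : Lp E p μ →L[ℝ] Lp E q μ :=
  (lpInclusionₗ E μ hqp).mkContinuous (μ univ ^ (1 / q.toReal - 1 / p.toReal)).toReal fun u => by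
    rcases eq_or_ne μ 0 with rfl | hμ
    · simp [Lp.norm_def]
    · have hKt : μ univ ^ (1 / q.toReal - 1 / p.toReal) ≠ ⊤ :=
        ENNReal.rpow_ne_top_of_ne_zero (by simpa using hμ) (by simp)
      rw [Lp.norm_def, Lp.norm_def, ← ENNReal.toReal_mul]
      refine ENNReal.toReal_mono (ENNReal.mul_ne_top hKt (Lp.eLpNorm_ne_top u)) ?_
      rw [eLpNorm_congr_ae (coeFn_lpInclusionₗ hqp u), mul_comm]
      exact eLpNorm_le_eLpNorm_mul_rpow_measure_univ hqp (Lp.aestronglyMeasurable u)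

theorem coeFn_lpInclusion {α E : Type*} [MeasurableSpace α] {μ : Measure α} [IsFiniteMeasure μ]
    [NormedAddCommGroup E] [NormedSpace ℝ E] {p q : ℝ≥0∞} [Fact (1 ≤ p)] [Fact (1 ≤ q)]
    (hqp : q ≤ p) (u : Lp E p μ) : lpInclusion E μ hqp u =ᵐ[μ] u := coeFn_lpInclusionₗ hqp u

/-- The inclusion `W₀^{1,p}(Ω) ⊂ W₀^{1,q}(Ω)` for `q ≤ p` and `Ω` of finite measure. -/
def inclusionW0 [IsFiniteMeasure ((volume : Measure (Euc n)).restrict Ω)] {q : ℝ≥0∞}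
    [Fact (1 ≤ q)] (hqp : q ≤ p) : W0 p Ω →L[ℝ] W0 q Ω :=
  (((lpInclusion ℝ (volume.restrict Ω) hqp).prodMap
    (lpInclusion (Euc n) (volume.restrict Ω) hqp)).comp (W0 p Ω).subtypeL).codRestrict (W0 q Ω) (by
      rintro ⟨u, hu⟩
      refine map_mem_closure (f := (lpInclusion ℝ (volume.restrict Ω) hqp).prodMap
        (lpInclusion (Euc n) (volume.restrict Ω) hqp)) (ContinuousLinearMap.continuous _) hu ?_
      rintro w ⟨φ, a1, a2, a3, a4, a5⟩
      exact ⟨φ, a1, a2, a3, EventuallyEq.trans (coeFn_lpInclusion hqp w.1) a4,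
        EventuallyEq.trans (coeFn_lpInclusion hqp w.2) a5⟩)

theorem sobFn_inclusionW0 [IsFiniteMeasure ((volume : Measure (Euc n)).restrict Ω)] {q : ℝ≥0∞}
    [Fact (1 ≤ q)] (hqp : q ≤ p) (u : W0 p Ω) :
    sobFn (inclusionW0 hqp u) =ᵐ[volume.restrict Ω] sobFn u :=
  coeFn_lpInclusion hqp (sobFnL p Ω u)

theorem sobGrad_inclusionW0 [IsFiniteMeasure ((volume : Measure (Euc n)).restrict Ω)] {q : ℝ≥0∞}
    [Fact (1 ≤ q)] (hqp : q ≤ p) (u : W0 p Ω) :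
    sobGrad (inclusionW0 hqp u) =ᵐ[volume.restrict Ω] sobGrad u :=
  coeFn_lpInclusion hqp (sobGradL p Ω u)

/-- The linear map `W₀^{1,p}(Ω) → L^∞(Ω)`, if it exists. -/
def sobSupₗ (h : ∀ u : W0 p Ω, MemLp (sobFn u) ⊤ (volume.restrict Ω)) :
    W0 p Ω →ₗ[ℝ] Lp ℝ ⊤ (volume.restrict Ω) where
  toFun u := (h u).toLp
  map_add' u w := by
    rw [← MemLp.toLp_add]
    exact MemLp.toLp_congr _ _ (sobFn_add u w)
  map_smul' c u := by
    rw [RingHom.id_apply, ← MemLp.toLp_const_smul]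
    exact MemLp.toLp_congr _ _ (sobFn_smul c u)

theorem coeFn_sobSupₗ (h : ∀ u : W0 p Ω, MemLp (sobFn u) ⊤ (volume.restrict Ω)) (u : W0 p Ω) :
    sobSupₗ h u =ᵐ[volume.restrict Ω] sobFn u := MemLp.coeFn_toLp (h u)

theorem memLp_top_sobFn {C : ℝ}
    (hC : ∀ u : W0 p Ω, ∀ᵐ x ∂(volume.restrict Ω), |sobFn u x| ≤ C * ‖u‖) (u : W0 p Ω) :
    MemLp (sobFn u) ⊤ (volume.restrict Ω) :=
  memLp_top_of_bound (memLp_sobFn u).1 (C * ‖u‖) (hC u)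

theorem norm_sobSupₗ_le {C : ℝ} (hC0 : 0 ≤ C)
    (hC : ∀ u : W0 p Ω, ∀ᵐ x ∂(volume.restrict Ω), |sobFn u x| ≤ C * ‖u‖) (u : W0 p Ω) :
    ‖sobSupₗ (memLp_top_sobFn hC) u‖ ≤ C * ‖u‖ := by
  rw [Lp.norm_def, eLpNorm_congr_ae (coeFn_sobSupₗ (memLp_top_sobFn hC) u), eLpNorm_exponent_top]
  exact ENNReal.toReal_le_of_le_ofReal (by positivity) (eLpNormEssSup_le_of_ae_bound (hC u))

/-- The map `W₀^{1,p}(Ω) → L^∞(Ω)`, given an `L^∞` bound. -/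
def sobSup {C : ℝ} (hC0 : 0 ≤ C)
    (hC : ∀ u : W0 p Ω, ∀ᵐ x ∂(volume.restrict Ω), |sobFn u x| ≤ C * ‖u‖) :
    W0 p Ω →L[ℝ] Lp ℝ ⊤ (volume.restrict Ω) :=
  (sobSupₗ (memLp_top_sobFn hC)).mkContinuous C (norm_sobSupₗ_le hC0 hC)

theorem coeFn_sobSup {C : ℝ} (hC0 : 0 ≤ C)
    (hC : ∀ u : W0 p Ω, ∀ᵐ x ∂(volume.restrict Ω), |sobFn u x| ≤ C * ‖u‖) (u : W0 p Ω) :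
    sobSup hC0 hC u =ᵐ[volume.restrict Ω] sobFn u :=
  coeFn_sobSupₗ (memLp_top_sobFn hC) u

/-- The bilinear map `(u, w) ↦ u w`, given an `L^∞` bound. -/
def sobMulFn {C : ℝ} (hC0 : 0 ≤ C)
    (hC : ∀ u : W0 p Ω, ∀ᵐ x ∂(volume.restrict Ω), |sobFn u x| ≤ C * ‖u‖) :
    W0 p Ω →L[ℝ] W0 p Ω →L[ℝ] Lp ℝ p (volume.restrict Ω) :=
  ((ContinuousLinearMap.lsmul ℝ ℝ : ℝ →L[ℝ] ℝ →L[ℝ] ℝ).holderL (volume.restrict Ω) ⊤ p p).bilinearComp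
    (sobSup hC0 hC) (sobFnL p Ω)

/-- The bilinear map `(u, w) ↦ u ∇w`, given an `L^∞` bound. -/
def sobMulGrad {C : ℝ} (hC0 : 0 ≤ C)
    (hC : ∀ u : W0 p Ω, ∀ᵐ x ∂(volume.restrict Ω), |sobFn u x| ≤ C * ‖u‖) :
    W0 p Ω →L[ℝ] W0 p Ω →L[ℝ] Lp (Euc n) p (volume.restrict Ω) :=
  ((ContinuousLinearMap.lsmul ℝ ℝ : ℝ →L[ℝ] Euc n →L[ℝ] Euc n).holderL
    (volume.restrict Ω) ⊤ p p).bilinearComp (sobSup hC0 hC) (sobGradL p Ω)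

section

variable {C : ℝ} (hC0 : 0 ≤ C)
    (hC : ∀ u : W0 p Ω, ∀ᵐ x ∂(volume.restrict Ω), |sobFn u x| ≤ C * ‖u‖)

theorem coeFn_sobMulFn (u w : W0 p Ω) :
    sobMulFn hC0 hC u w =ᵐ[volume.restrict Ω] fun x => sobFn u x * sobFn w x := by
  filter_upwards [coeFn_sobSup hC0 hC u,
    (ContinuousLinearMap.lsmul ℝ ℝ : ℝ →L[ℝ] ℝ →L[ℝ] ℝ).coeFn_holder
      (r := p) (sobSup hC0 hC u) (sobFnL p Ω w)] with x h1 h2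
  refine h2.trans ?_
  rw [h1, coeFn_sobFnL]
  rfl

theorem coeFn_sobMulGrad (u w : W0 p Ω) :
    sobMulGrad hC0 hC u w =ᵐ[volume.restrict Ω] fun x => sobFn u x • sobGrad w x := by
  filter_upwards [coeFn_sobSup hC0 hC u,
    (ContinuousLinearMap.lsmul ℝ ℝ : ℝ →L[ℝ] Euc n →L[ℝ] Euc n).coeFn_holder
      (r := p) (sobSup hC0 hC u) (sobGradL p Ω w)] with x h1 h2
  refine h2.trans ?_
  rw [h1, coeFn_sobGradL]
  rfl

/-- The bilinear map `(u, w) ↦ (u w, ∇(u w))`, given an `L^∞` bound. -/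
def sobMulPair : W0 p Ω →L[ℝ] W0 p Ω →L[ℝ]
    Lp ℝ p (volume.restrict Ω) × Lp (Euc n) p (volume.restrict Ω) :=
  bilinProd (sobMulFn hC0 hC) (sobMulGrad hC0 hC + (sobMulGrad hC0 hC).flip)

theorem coeFn_sobMulPair_fst (u w : W0 p Ω) :
    (sobMulPair hC0 hC u w).1 =ᵐ[volume.restrict Ω] fun x => sobFn u x * sobFn w x := by
  rw [sobMulPair, bilinProd_apply]
  exact coeFn_sobMulFn hC0 hC u w

theorem coeFn_sobMulPair_snd (u w : W0 p Ω) :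
    (sobMulPair hC0 hC u w).2 =ᵐ[volume.restrict Ω]
      fun x => sobFn u x • sobGrad w x + sobFn w x • sobGrad u x := by
  rw [sobMulPair, bilinProd_apply]
  exact (Lp.coeFn_add _ _).trans ((coeFn_sobMulGrad hC0 hC u w).add (coeFn_sobMulGrad hC0 hC w u))

theorem sobMulPair_toW0_mem {φ ψ : Euc n → ℝ} (h : IsSpaceTest Ω φ) (k : IsSpaceTest Ω ψ) :
    sobMulPair hC0 hC (h.toW0 p) (k.toW0 p) ∈ W0 p Ω := by
  refine subset_closure ⟨φ * ψ, (h.mul k).1, (h.mul k).2.1, (h.mul k).2.2, ?_, ?_⟩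
  · filter_upwards [coeFn_sobMulPair_fst hC0 hC (h.toW0 p) (k.toW0 p), h.sobFn_toW0 (p := p),
      k.sobFn_toW0 (p := p)] with x h1 h2 h3
    rw [h1, h2, h3]
    rfl
  · filter_upwards [coeFn_sobMulPair_snd hC0 hC (h.toW0 p) (k.toW0 p), h.sobFn_toW0 (p := p),
      k.sobFn_toW0 (p := p), h.sobGrad_toW0 (p := p), k.sobGrad_toW0 (p := p)]
      with x h1 h2 h3 h4 h5
    rw [h1, h2, h3, h4, h5, gradient_mul h.1 k.1]

/-- A product of test functions is a test function with the Leibniz gradient. Density and joint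
continuity do the rest, since W₀^{1,p}(Ω) is closed. -/
theorem sobMulPair_mem (u w : W0 p Ω) : sobMulPair hC0 hC u w ∈ W0 p Ω := by
  refine bilin_mem_of_dense (sobMulPair hC0 hC) (Submodule.isClosed_topologicalClosure _)
    (dense_toW0 p Ω) ?_ u w
  rintro _ ⟨φ, h, rfl⟩ _ ⟨ψ, k, rfl⟩
  exact sobMulPair_toW0_mem hC0 hC h k

/-- The multiplication of `W₀^{1,p}(Ω)`, given an `L^∞` bound. -/
def sobMul : W0 p Ω →L[ℝ] W0 p Ω →L[ℝ] W0 p Ω :=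
  bilinCodRestrict (sobMulPair hC0 hC) (W0 p Ω) (sobMulPair_mem hC0 hC)

theorem sobFn_sobMul (u w : W0 p Ω) :
    sobFn (sobMul hC0 hC u w) =ᵐ[volume.restrict Ω] fun x => sobFn u x * sobFn w x :=
  coeFn_sobMulPair_fst hC0 hC u w

theorem sobGrad_sobMul (u w : W0 p Ω) :
    sobGrad (sobMul hC0 hC u w) =ᵐ[volume.restrict Ω] fun x =>
      sobFn u x • sobGrad w x + sobFn w x • sobGrad u x :=
  coeFn_sobMulPair_snd hC0 hC u w

end

end Sobolev

/-! ### Measurability and continuity of superposition with f. -/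

section Superposition

/-- If `g u` is measurable for every `u` and `u ↦ g u t` is continuous for almost every `t`, then
`t ↦ g (V t) t` is measurable for every measurable `V`. -/
theorem aestronglyMeasurable_eval {α W : Type*} [MeasurableSpace α] {μ : Measure α}
    [TopologicalSpace W] {g : W → α → ℝ} (hm : ∀ u, AEStronglyMeasurable (g u) μ)
    (hc : ∀ᵐ t ∂μ, Continuous fun u => g u t) {V : α → W} (hV : AEStronglyMeasurable V μ) :
    AEStronglyMeasurable (fun t => g (V t) t) μ := by
  -- For simple V the composite is a finite sum of `g c` over the fibres; continuity in u then
  -- handles limits of simple functions.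
  have hsimple : ∀ s : SimpleFunc α W, AEStronglyMeasurable (fun t => g (s t) t) μ := by
    intro s
    have h : (fun t => g (s t) t) =
        fun t => ∑ c ∈ s.range, (s ⁻¹' {c}).indicator (g c) t := by
      ext t
      rw [Finset.sum_eq_single (s t)]
      · simp
      · intro c _ hc
        simp [indicator, hc.symm]
      · intro h
        exact absurd (SimpleFunc.mem_range_self s t) h
    rw [h]
    exact Finset.aestronglyMeasurable_fun_sum _ fun c _ =>
      (hm c).indicator (s.measurableSet_fiber c)
  have hmk : AEStronglyMeasurable (fun t => g (hV.mk V t) t) μ := by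
    refine aestronglyMeasurable_of_tendsto_ae atTop
      (fun k => hsimple (hV.stronglyMeasurable_mk.approx k)) ?_
    filter_upwards [hc] with t ht
    exact (ht.tendsto _).comp (hV.stronglyMeasurable_mk.tendsto_approx t)
  refine hmk.congr ?_
  filter_upwards [hV.ae_eq_mk] with t ht
  rw [ht]

/-- `g` is a locally bounded Carathéodory function. -/
structure IsCaratheodory {α : Type*} [MeasurableSpace α] (μ : Measure α) (g : α → ℝ → ℝ)
    (M : ℕ → ℝ) : Prop where
  measurable : ∀ u, AEStronglyMeasurable (fun x => g x u) μ
  continuous : ∀ᵐ x ∂μ, Continuous (g x)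
  bounded : ∀ k : ℕ, ∀ᵐ x ∂μ, ∀ u ∈ Icc (-k : ℝ) k, |g x u| ≤ M k

theorem IsCaratheodory.comp {α : Type*} [MeasurableSpace α] {μ : Measure α} {g : α → ℝ → ℝ}
    {M : ℕ → ℝ} (hg : IsCaratheodory μ g M) {u : α → ℝ} (hu : AEStronglyMeasurable u μ) :
    AEStronglyMeasurable (fun x => g x (u x)) μ :=
  aestronglyMeasurable_eval (g := fun u x => g x u) hg.measurable hg.continuous hu

variable {n : ℕ} {T : ℝ} {Ω : Set (Euc n)} {f : ℝ → Euc n → ℝ → ℝ}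

theorem IsLocallyBounded.comp_snd (hf : IsLocallyBounded T Ω f) {u : Euc n → ℝ}
    (hu : AEStronglyMeasurable u (volume.restrict Ω)) :
    AEStronglyMeasurable (fun q : ℝ × Euc n => f q.1 q.2 (u q.2)) (cylMeasure T Ω) :=
  aestronglyMeasurable_eval (g := fun u q => f q.1 q.2 u)
    (fun y => (hf.measurable y).aestronglyMeasurable) hf.continuous hu.comp_snd

/-- Fubini passes almost everywhere statements to slices, but only countably many at a time.
Measurability is therefore sliced at rational u and recovered at real u by continuity. -/
theorem IsLocallyBounded.exists_isCaratheodory (hf : IsLocallyBounded T Ω f) :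
    ∃ M : ℕ → ℝ, (∀ k, 0 ≤ M k) ∧
      ∀ᵐ t ∂(volume.restrict (Ioo 0 T)), IsCaratheodory (volume.restrict Ω) (f t) M := by
  choose M hM0 hM using fun k : ℕ => hf.bounded (Icc (-k : ℝ) k) isCompact_Icc
  refine ⟨M, hM0, ?_⟩
  have h1 : ∀ᵐ t ∂(volume.restrict (Ioo 0 T)), ∀ q : ℚ,
      AEStronglyMeasurable (fun x => f t x q) (volume.restrict Ω) :=
    ae_all_iff.2 fun q => (hf.measurable q).aestronglyMeasurable.prodMk_left
  have h2 := Measure.ae_ae_of_ae_prod hf.continuous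
  have h3 := ae_all_iff.2 fun k => Measure.ae_ae_of_ae_prod (hM k)
  filter_upwards [h1, h2, h3] with t h1 h2 h3
  refine ⟨fun u => ?_, h2, h3⟩
  obtain ⟨s, hs⟩ : ∃ s : ℕ → ℚ, Tendsto (fun k => (s k : ℝ)) atTop (𝓝 u) := by
    obtain ⟨s, hs, hsu⟩ := mem_closure_iff_seq_limit.1 (Rat.denseRange_cast (𝕜 := ℝ) u)
    choose q hq using hs
    exact ⟨q, by simpa [hq] using hsu⟩
  refine aestronglyMeasurable_of_tendsto_ae atTop (fun k => h1 (s k)) ?_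
  filter_upwards [h2] with x hx
  exact (hx.tendsto u).comp hs

variable {r : ℝ} [hr : Fact (2 ≤ r)]

theorem IsCaratheodory.abs_comp_le {M : ℕ → ℝ} {g : Euc n → ℝ → ℝ}
    (hg : IsCaratheodory (volume.restrict Ω) g M) {u : Euc n → ℝ} {k : ℕ}
    (hu : ∀ᵐ x ∂(volume.restrict Ω), |u x| ≤ k) :
    ∀ᵐ x ∂(volume.restrict Ω), |g x (u x)| ≤ M k := by
  filter_upwards [hg.bounded k, hu] with x h1 h2
  exact h1 _ (abs_le.1 h2)

/-- Superposition operators are continuous on spaces embedded into `L^∞`. -/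
theorem IsCaratheodory.continuous_integral {p : ℝ≥0∞} [Fact (1 ≤ p)] {C : ℝ}
    (hC : ∀ u : W0 p Ω, ∀ᵐ x ∂(volume.restrict Ω), |sobFn u x| ≤ C * ‖u‖)
    {M : ℕ → ℝ} {g : Euc n → ℝ → ℝ}
    (hg : IsCaratheodory (volume.restrict Ω) g M) {v : Euc n → ℝ} (hv : IntegrableOn v Ω) :
    Continuous fun u : W0 p Ω => ∫ x in Ω, v x * g x (sobFn u x) := by
  refine continuous_iff_seqContinuous.2 fun w u hwu => ?_
  -- A convergent sequence is bounded, so all its values lie in one interval [-k, k], which supplies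
  -- the dominating function |v| M k.
  have hbd : ∃ k : ℕ, ∀ j, C * ‖w j‖ ≤ k := by
    obtain ⟨B, hB⟩ := (((continuous_norm.tendsto u).comp hwu).const_mul C).bddAbove_range
    obtain ⟨k, hk⟩ := exists_nat_ge B
    exact ⟨k, fun j => (hB ⟨j, rfl⟩).trans hk⟩
  obtain ⟨k, hk⟩ := hbd
  refine tendsto_integral_of_dominated_convergence (fun x => |v x| * M k) (fun j => ?_)
    (hv.abs.mul_const _) (fun j => ?_) ?_
  · exact hv.1.mul (hg.comp (memLp_sobFn (w j)).1)
  · filter_upwards [hg.abs_comp_le (k := k) ((hC (w j)).mono fun x hx => hx.trans (hk j))] with x hx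
    rw [norm_mul, Real.norm_eq_abs, Real.norm_eq_abs]
    gcongr
  · have hd : ∀ j, ∀ᵐ x ∂(volume.restrict Ω), |sobFn (w j) x - sobFn u x| ≤ C * ‖w j - u‖ := by
      intro j
      filter_upwards [hC (w j - u), sobFn_sub (w j) u] with x h1 h2
      rwa [h2] at h1
    have h0 : Tendsto (fun j => C * ‖w j - u‖) atTop (𝓝 0) := by
      simpa using (tendsto_iff_norm_sub_tendsto_zero.1 hwu).const_mul C
    filter_upwards [hg.continuous, ae_all_iff.2 hd] with x hx1 hx2
    have : Tendsto (fun j => sobFn (w j) x) atTop (𝓝 (sobFn u x)) := by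
      rw [tendsto_iff_norm_sub_tendsto_zero]
      exact squeeze_zero (fun _ => norm_nonneg _) hx2 h0
    exact ((hx1.tendsto _).comp this).const_mul _

/-- The pair (t, u) ↦ ∫ v f(t,·,u) is itself Carathéodory, with u ranging over W₀^{1,p}. This avoids
joint measurability of (t, x) ↦ V(t)(x), which representatives chosen slice by slice need not have.
-/
theorem IsLocallyBounded.aestronglyMeasurable_integral {p : ℝ≥0∞} [Fact (1 ≤ p)] {C : ℝ}
    (hC : ∀ u : W0 p Ω, ∀ᵐ x ∂(volume.restrict Ω), |sobFn u x| ≤ C * ‖u‖)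
    (hf : IsLocallyBounded T Ω f) {v : Euc n → ℝ} (hv : IntegrableOn v Ω)
    {V : ℝ → W0 p Ω} (hV : AEStronglyMeasurable V (volume.restrict (Ioo 0 T))) :
    AEStronglyMeasurable (fun t => ∫ x in Ω, v x * f t x (sobFn (V t) x))
      (volume.restrict (Ioo 0 T)) := by
  obtain ⟨M, -, hM⟩ := hf.exists_isCaratheodory
  refine aestronglyMeasurable_eval (g := fun u t => ∫ x in Ω, v x * f t x (sobFn u x))
    (fun u => ?_) (hM.mono fun t ht => ht.continuous_integral hC hv) hV
  have h : AEStronglyMeasurable (fun q : ℝ × Euc n => v q.2 * f q.1 q.2 (sobFn u q.2))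
      ((volume.restrict (Ioo 0 T)).prod (volume.restrict Ω)) :=
    hv.1.comp_snd.mul (hf.comp_snd (memLp_sobFn u).1)
  exact h.integral_prod_right'

end Superposition

/-! ### Bounded functionals on H₀¹(Ω) in divergence form. -/

section WeakForm

variable {n : ℕ} {Ω : Set (Euc n)}

theorem integrable_mul_of_memLp_two {α : Type*} [MeasurableSpace α] {μ : Measure α} {a b : α → ℝ}
    (ha : MemLp a 2 μ) (hb : MemLp b 2 μ) : Integrable (fun x => a x * b x) μ :=
  ha.integrable_mul hb

theorem integrable_inner_of_memLp_two {α : Type*} [MeasurableSpace α] {μ : Measure α}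
    {a b : α → Euc n} (ha : MemLp a 2 μ) (hb : MemLp b 2 μ) :
    Integrable (fun x => ⟪a x, b x⟫) μ := by
  refine (L2.integrable_inner (𝕜 := ℝ) (ha.toLp) (hb.toLp)).congr ?_
  filter_upwards [ha.coeFn_toLp, hb.coeFn_toLp] with x h1 h2
  rw [h1, h2]

/-- The functional `v ↦ ∫ v a + ∇v · b` on `H₀¹(Ω)`. -/
def weakForm {a : Euc n → ℝ} {b : Euc n → Euc n} (ha : MemLp a 2 (volume.restrict Ω))
    (hb : MemLp b 2 (volume.restrict Ω)) : H10 Ω →L[ℝ] ℝ :=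
  (innerSL ℝ ha.toLp).comp (sobFnL 2 Ω) + (innerSL ℝ hb.toLp).comp (sobGradL 2 Ω)

theorem integrable_weakForm {a : Euc n → ℝ} {b : Euc n → Euc n}
    (ha : MemLp a 2 (volume.restrict Ω)) (hb : MemLp b 2 (volume.restrict Ω)) (v : H10 Ω) :
    IntegrableOn (fun x => sobFn v x * a x + ⟪sobGrad v x, b x⟫) Ω :=
  (integrable_mul_of_memLp_two (memLp_sobFn v) ha).add
    (integrable_inner_of_memLp_two (memLp_sobGrad v) hb)

theorem weakForm_apply {a : Euc n → ℝ} {b : Euc n → Euc n} (ha : MemLp a 2 (volume.restrict Ω))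
    (hb : MemLp b 2 (volume.restrict Ω)) (v : H10 Ω) :
    weakForm ha hb v = ∫ x in Ω, (sobFn v x * a x + ⟪sobGrad v x, b x⟫) := by
  rw [integral_add (integrable_mul_of_memLp_two (memLp_sobFn v) ha)
    (integrable_inner_of_memLp_two (memLp_sobGrad v) hb)]
  simp only [weakForm, add_apply, ContinuousLinearMap.comp_apply, innerSL_apply_apply]
  rw [L2.inner_def, L2.inner_def]
  congr 1
  · refine integral_congr_ae ?_
    filter_upwards [ha.coeFn_toLp] with x h1
    rw [h1, coeFn_sobFnL]
    simp
  · refine integral_congr_ae ?_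
    filter_upwards [hb.coeFn_toLp] with x h1
    rw [h1, coeFn_sobGradL, real_inner_comm]

end WeakForm

/-! ### From the space-time equation to almost every time slice. -/

section WeakSolution

variable {n : ℕ} {T r : ℝ} [hr : Fact (2 ≤ r)] {Ω : Set (Euc n)} {f : ℝ → Euc n → ℝ → ℝ}

theorem isFiniteMeasure_restrict_of_isBounded (hΩ : Bornology.IsBounded Ω) :
    IsFiniteMeasure ((volume : Measure (Euc n)).restrict Ω) :=
  ⟨by simpa using hΩ.measure_lt_top⟩

theorem two_le_ofReal (r : ℝ) [hr : Fact (2 ≤ r)] : 2 ≤ ENNReal.ofReal r := by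
  rw [← ENNReal.ofReal_ofNat]
  exact ENNReal.ofReal_le_ofReal hr.out

/-- Separability provides a countable family of test functions whose exceptional sets of times have
a null union. -/
instance : SecondCountableTopology (H10 Ω) :=
  have : Fact ((2 : ℝ≥0∞) ≠ ⊤) := ⟨by simp⟩
  have h₁ : SecondCountableTopology (Lp ℝ 2 ((volume : Measure (Euc n)).restrict Ω)) :=
    inferInstance
  have h₂ : SecondCountableTopology (Lp (Euc n) 2 ((volume : Measure (Euc n)).restrict Ω)) :=
    inferInstance
  TopologicalSpace.Subtype.secondCountableTopology
    (W0 2 Ω : Set (Lp ℝ 2 (volume.restrict Ω) × Lp (Euc n) 2 (volume.restrict Ω)))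

theorem memLp_two_sobFn [IsFiniteMeasure ((volume : Measure (Euc n)).restrict Ω)]
    (u : W0 (ENNReal.ofReal r) Ω) : MemLp (sobFn u) 2 (volume.restrict Ω) :=
  (memLp_sobFn u).mono_exponent (two_le_ofReal r)

theorem memLp_two_sobGrad [IsFiniteMeasure ((volume : Measure (Euc n)).restrict Ω)]
    (u : W0 (ENNReal.ofReal r) Ω) : MemLp (sobGrad u) 2 (volume.restrict Ω) :=
  (memLp_sobGrad u).mono_exponent (two_le_ofReal r)

/-- The continuous representative is bounded on the compact [0,T]. The bound confines y to a compact
range for f and keeps y² square integrable in time. -/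
theorem IsWeakSolution.exists_ae_norm_le {y₀ : W0 (ENNReal.ofReal r) Ω} {y : Xr T r Ω}
    (hy : IsWeakSolution f y₀ y) :
    ∃ R, ∀ᵐ t ∂(volume.restrict (Ioo 0 T)), ‖y.val t‖ ≤ R := by
  obtain ⟨yc, hc, hae, -⟩ := hy.initial
  obtain ⟨R, hR⟩ := isCompact_Icc.exists_bound_of_continuousOn hc
  refine ⟨R, ?_⟩
  filter_upwards [hae, ae_restrict_mem measurableSet_Ioo] with t h1 h2
  rw [← h1]
  exact hR t (Ioo_subset_Icc_self h2)

/-- The reaction term along a weak solution is essentially bounded. -/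
theorem IsWeakSolution.exists_ae_reaction_bound {C : ℝ} (hC0 : 0 ≤ C)
    (hC : ∀ u : W0 (ENNReal.ofReal r) Ω, ∀ᵐ x ∂(volume.restrict Ω), |sobFn u x| ≤ C * ‖u‖)
    (hf : IsLocallyBounded T Ω f) {y₀ : W0 (ENNReal.ofReal r) Ω} {y : Xr T r Ω}
    (hy : IsWeakSolution f y₀ y) :
    ∃ M : ℝ, 0 ≤ M ∧ ∀ᵐ t ∂(volume.restrict (Ioo 0 T)),
      AEStronglyMeasurable (fun x => f t x (y.fn t x)) (volume.restrict Ω) ∧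
      ∀ᵐ x ∂(volume.restrict Ω), |f t x (y.fn t x)| ≤ M := by
  obtain ⟨M, hM0, hM⟩ := hf.exists_isCaratheodory
  obtain ⟨R, hR⟩ := hy.exists_ae_norm_le
  obtain ⟨k, hk⟩ := exists_nat_ge (C * R)
  refine ⟨M k, hM0 k, ?_⟩
  filter_upwards [hM, hR] with t h1 h2
  refine ⟨h1.comp (memLp_sobFn (y.val t)).1, h1.abs_comp_le ?_⟩
  filter_upwards [hC (y.val t)] with x hx
  exact hx.trans ((mul_le_mul_of_nonneg_left h2 hC0).trans hk)

theorem IsLocallyBounded.aestronglyMeasurable_integral_fn {C : ℝ}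
    (hC : ∀ u : W0 (ENNReal.ofReal r) Ω, ∀ᵐ x ∂(volume.restrict Ω), |sobFn u x| ≤ C * ‖u‖)
    (hf : IsLocallyBounded T Ω f) {v : Euc n → ℝ} (hv : IntegrableOn v Ω) (y : Xr T r Ω) :
    AEStronglyMeasurable (fun t => ∫ x in Ω, v x * f t x (y.fn t x)) (volume.restrict (Ioo 0 T)) :=
  hf.aestronglyMeasurable_integral hC hv y.integrable_val.1

/-- The functional `u ↦ ∫ v u` on `W₀^{1,r}(Ω)`. -/
def pairFn [IsFiniteMeasure ((volume : Measure (Euc n)).restrict Ω)] (r : ℝ) [Fact (2 ≤ r)]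
    (v : H10 Ω) : W0 (ENNReal.ofReal r) Ω →L[ℝ] ℝ :=
  (weakForm (memLp_sobFn v) (MemLp.zero (ε := Euc n))).comp (inclusionW0 (two_le_ofReal r))

/-- The functional `u ↦ ∫ ∇v · ∇u` on `W₀^{1,r}(Ω)`. -/
def pairGrad [IsFiniteMeasure ((volume : Measure (Euc n)).restrict Ω)] (r : ℝ) [Fact (2 ≤ r)]
    (v : H10 Ω) : W0 (ENNReal.ofReal r) Ω →L[ℝ] ℝ :=
  (weakForm (MemLp.zero (ε := ℝ)) (memLp_sobGrad v)).comp (inclusionW0 (two_le_ofReal r))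

theorem pairFn_apply [IsFiniteMeasure ((volume : Measure (Euc n)).restrict Ω)] (v : H10 Ω)
    (u : W0 (ENNReal.ofReal r) Ω) : pairFn r v u = ∫ x in Ω, sobFn v x * sobFn u x := by
  rw [pairFn, ContinuousLinearMap.comp_apply, weakForm_apply]
  refine integral_congr_ae ?_
  filter_upwards [sobFn_inclusionW0 (two_le_ofReal r) u] with x hx
  simp [hx, mul_comm]

theorem pairGrad_apply [IsFiniteMeasure ((volume : Measure (Euc n)).restrict Ω)] (v : H10 Ω)
    (u : W0 (ENNReal.ofReal r) Ω) : pairGrad r v u = ∫ x in Ω, ⟪sobGrad v x, sobGrad u x⟫ := by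
  rw [pairGrad, ContinuousLinearMap.comp_apply, weakForm_apply]
  refine integral_congr_ae ?_
  filter_upwards [sobGrad_inclusionW0 (two_le_ofReal r) u] with x hx
  simp [hx, real_inner_comm]

/-- Expresses the linear part of the slice integral through continuous functionals on W₀^{1,r}, so
that its integrability in t follows from that of the Bochner functions. -/
theorem pair_sub_eq_integral [IsFiniteMeasure ((volume : Measure (Euc n)).restrict Ω)] (v : H10 Ω)
    (u w : W0 (ENNReal.ofReal r) Ω) {F : Euc n → ℝ} {M : ℝ}
    (hF : AEStronglyMeasurable F (volume.restrict Ω))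
    (hM : ∀ᵐ x ∂(volume.restrict Ω), |F x| ≤ M) :
    pairFn r v u + pairGrad r v w - ∫ x in Ω, sobFn v x * F x =
      ∫ x in Ω, (sobFn v x * (sobFn u x - F x) + ⟪sobGrad v x, sobGrad w x⟫) := by
  have i1 : IntegrableOn (fun x => sobFn v x * sobFn u x) Ω :=
    integrable_mul_of_memLp_two (memLp_sobFn v) (memLp_two_sobFn _)
  have i2 : IntegrableOn (fun x => ⟪sobGrad v x, sobGrad w x⟫) Ω :=
    integrable_inner_of_memLp_two (memLp_sobGrad v) (memLp_two_sobGrad _)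
  have i3 : IntegrableOn (fun x => sobFn v x * F x) Ω :=
    ((memLp_sobFn v).integrable (by norm_num)).mul_bdd (c := M) hF hM
  have i4 : IntegrableOn (fun x => sobFn v x * sobFn u x + ⟪sobGrad v x, sobGrad w x⟫) Ω :=
    i1.add i2
  rw [pairFn_apply, pairGrad_apply, ← integral_add i1 i2, ← integral_sub i4 i3]
  refine integral_congr_ae (.of_forall fun x => ?_)
  ring

theorem IsWeakSolution.integrableOn_weak_eq
    [IsFiniteMeasure ((volume : Measure (Euc n)).restrict Ω)] {C : ℝ} (hC0 : 0 ≤ C)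
    (hC : ∀ u : W0 (ENNReal.ofReal r) Ω, ∀ᵐ x ∂(volume.restrict Ω), |sobFn u x| ≤ C * ‖u‖)
    (hf : IsLocallyBounded T Ω f) {y₀ : W0 (ENNReal.ofReal r) Ω} {y : Xr T r Ω}
    (hy : IsWeakSolution f y₀ y) (v : H10 Ω) :
    IntegrableOn (fun t => ∫ x in Ω, (sobFn v x * (y.timeDeriv t x -
      f t x (y.fn t x)) + ⟪sobGrad v x, y.spaceGrad t x⟫)) (Ioo 0 T) := by
  obtain ⟨M, hM0, hM⟩ := hy.exists_ae_reaction_bound hC0 hC hf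
  have hv1 : IntegrableOn (sobFn v) Ω := (memLp_sobFn v).integrable (by norm_num)
  have i3 : Integrable (fun t => ∫ x in Ω, sobFn v x * f t x (y.fn t x))
      (volume.restrict (Ioo 0 T)) := by
    refine Integrable.of_bound (hf.aestronglyMeasurable_integral_fn hC hv1 y)
      (∫ x in Ω, |sobFn v x| * M) ?_
    filter_upwards [hM] with t ht
    refine norm_integral_le_of_norm_le (hv1.abs.mul_const M) ?_
    filter_upwards [ht.2] with x hx
    rw [norm_mul, Real.norm_eq_abs, Real.norm_eq_abs]
    gcongr
  refine (((y.integrable_clm_dt (pairFn r v)).add (y.integrable_clm_val (pairGrad r v))).sub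
    i3).congr ?_
  filter_upwards [hM] with t ht
  exact pair_sub_eq_integral v (y.dt t) (y.val t) ht.1 ht.2

/-- For fixed v the factor φ(t) comes out of the inner integral, and the fundamental lemma of the
calculus of variations applies in t. The null set still depends on v. -/
theorem IsWeakSolution.ae_weak_eq_of_fixed [IsFiniteMeasure ((volume : Measure (Euc n)).restrict Ω)]
    {C : ℝ} (hC0 : 0 ≤ C)
    (hC : ∀ u : W0 (ENNReal.ofReal r) Ω, ∀ᵐ x ∂(volume.restrict Ω), |sobFn u x| ≤ C * ‖u‖)
    (hf : IsLocallyBounded T Ω f) {y₀ : W0 (ENNReal.ofReal r) Ω} {y : Xr T r Ω}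
    (hy : IsWeakSolution f y₀ y) (v : H10 Ω) :
    ∀ᵐ t ∂(volume.restrict (Ioo 0 T)), ∫ x in Ω, (sobFn v x * (y.timeDeriv t x -
      f t x (y.fn t x)) + ⟪sobGrad v x, y.spaceGrad t x⟫) = 0 := by
  have key : ∀ᵐ t : ℝ, t ∈ Ioo 0 T → ∫ x in Ω, (sobFn v x * (y.timeDeriv t x -
      f t x (y.fn t x)) + ⟪sobGrad v x, y.spaceGrad t x⟫) = 0 := by
    refine isOpen_Ioo.ae_eq_zero_of_integral_contDiff_smul_eq_zero
      (hy.integrableOn_weak_eq hC0 hC hf v).locallyIntegrableOn fun φ h1 h2 h3 => ?_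
    have hφ : IsTimeTest T φ := ⟨h1, h2, h3⟩
    have e0 : ∀ t ∉ Ioo 0 T, φ t • ∫ x in Ω, (sobFn v x * (y.timeDeriv t x -
        f t x (y.fn t x)) + ⟪sobGrad v x, y.spaceGrad t x⟫) = 0 := fun t ht => by
      rw [hφ.eq_zero ht, zero_smul]
    rw [← setIntegral_eq_integral_of_forall_compl_eq_zero e0]
    refine Eq.trans ?_ (hy.weak_eq v φ hφ)
    refine integral_congr_ae (.of_forall fun t => ?_)
    beta_reduce
    rw [smul_eq_mul, ← integral_const_mul]
    refine integral_congr_ae (.of_forall fun x => ?_)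
    ring
  filter_upwards [ae_restrict_of_ae key, ae_restrict_mem measurableSet_Ioo] with t h1 h2
  exact h1 h2

/-- The weak equation holds for almost every `t`, simultaneously for all test functions. -/
theorem IsWeakSolution.ae_weak_eq [IsFiniteMeasure ((volume : Measure (Euc n)).restrict Ω)]
    {C : ℝ} (hC0 : 0 ≤ C)
    (hC : ∀ u : W0 (ENNReal.ofReal r) Ω, ∀ᵐ x ∂(volume.restrict Ω), |sobFn u x| ≤ C * ‖u‖)
    (hf : IsLocallyBounded T Ω f) {y₀ : W0 (ENNReal.ofReal r) Ω} {y : Xr T r Ω}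
    (hy : IsWeakSolution f y₀ y) :
    ∀ᵐ t ∂(volume.restrict (Ioo 0 T)),
      MemLp (fun x => f t x (y.fn t x)) ⊤ (volume.restrict Ω) ∧
      ∀ v : H10 Ω, ∫ x in Ω, (sobFn v x * (y.timeDeriv t x -
        f t x (y.fn t x)) + ⟪sobGrad v x, y.spaceGrad t x⟫) = 0 := by
  obtain ⟨M, hM0, hM⟩ := hy.exists_ae_reaction_bound hC0 hC hf
  have hd := ae_all_iff.2 fun k : ℕ =>
    hy.ae_weak_eq_of_fixed hC0 hC hf (TopologicalSpace.denseSeq (H10 Ω) k)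
  filter_upwards [hM, hd] with t h1 h2
  have hF : MemLp (fun x => f t x (y.fn t x)) ⊤ (volume.restrict Ω) :=
    memLp_top_of_bound h1.1 M h1.2
  refine ⟨hF, ?_⟩
  have ha : MemLp (fun x => y.timeDeriv t x - f t x (y.fn t x)) 2 (volume.restrict Ω) :=
    (memLp_two_sobFn (y.dt t)).sub (hF.mono_exponent le_top)
  have hb : MemLp (y.spaceGrad t) 2 (volume.restrict Ω) := memLp_two_sobGrad (y.val t)
  -- The left side is a bounded functional of v, so vanishing on a dense sequence is enough.
  have h0 : (fun v => weakForm ha hb v) = fun _ => 0 :=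
    Continuous.ext_on (TopologicalSpace.denseRange_denseSeq (H10 Ω)) (weakForm ha hb).continuous
      continuous_const (by
        rintro _ ⟨k, rfl⟩
        exact (weakForm_apply ha hb _).trans (h2 k))
  intro v
  rw [← weakForm_apply ha hb]
  exact congrFun h0 v

end WeakSolution

/-! ### Extending a nonnegative weight from test functions to H₀¹(Ω). -/

section NonnegativeDensity

variable {n : ℕ} {Ω : Set (Euc n)}

/-- A smooth approximation of the absolute value, vanishing at `0`. -/
def smoothAbs (ε s : ℝ) : ℝ := Real.sqrt (s ^ 2 + ε ^ 2) - ε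

theorem smoothAbs_zero {ε : ℝ} (hε : 0 < ε) : smoothAbs ε 0 = 0 := by
  simp [smoothAbs, Real.sqrt_sq hε.le]

theorem smoothAbs_nonneg (ε s : ℝ) : 0 ≤ smoothAbs ε s := by
  rw [smoothAbs, sub_nonneg]
  exact Real.le_sqrt_of_sq_le (by nlinarith [sq_nonneg s])

theorem smoothAbs_le {ε : ℝ} (hε : 0 < ε) (s : ℝ) : smoothAbs ε s ≤ |s| := by
  rw [smoothAbs, sub_le_iff_le_add, Real.sqrt_le_left (by positivity)]
  nlinarith [abs_nonneg s, sq_abs s]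

theorem abs_le_smoothAbs_add (ε s : ℝ) : |s| ≤ smoothAbs ε s + ε := by
  rw [smoothAbs, sub_add_cancel]
  exact Real.abs_le_sqrt (by nlinarith [sq_nonneg ε])

theorem contDiff_smoothAbs {ε : ℝ} (hε : 0 < ε) : ContDiff ℝ ∞ (smoothAbs ε) :=
  (ContDiff.sqrt (by fun_prop) fun s => by positivity).sub contDiff_const

theorem norm_deriv_smoothAbs_le {ε : ℝ} (hε : 0 < ε) (s : ℝ) : ‖deriv (smoothAbs ε) s‖ ≤ 1 := by
  have hpos : 0 < s ^ 2 + ε ^ 2 := by positivity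
  have h : HasDerivAt (smoothAbs ε) (2 * s / (2 * Real.sqrt (s ^ 2 + ε ^ 2))) s := by
    have h1 : HasDerivAt (fun s : ℝ => s ^ 2 + ε ^ 2) (2 * s) s := by
      simpa using (hasDerivAt_pow 2 s).add_const (ε ^ 2)
    exact (h1.sqrt hpos.ne').sub_const ε
  rw [h.deriv, norm_div, Real.norm_eq_abs, Real.norm_eq_abs, abs_mul, abs_mul, abs_two,
    abs_of_nonneg (Real.sqrt_nonneg _), div_le_one (by positivity)]
  gcongr
  exact Real.abs_le_sqrt (by nlinarith [sq_nonneg ε])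

theorem IsSpaceTest.smoothAbs {φ : Euc n → ℝ} (h : IsSpaceTest Ω φ) {ε : ℝ} (hε : 0 < ε) :
    IsSpaceTest Ω (fun x => smoothAbs ε (φ x)) :=
  ⟨(contDiff_smoothAbs hε).comp h.1, h.2.1.comp_left (smoothAbs_zero hε),
    (tsupport_comp_subset (smoothAbs_zero hε) φ).trans h.2.2⟩

theorem IsSpaceTest.norm_gradient_smoothAbs_le {φ : Euc n → ℝ} (h : IsSpaceTest Ω φ) {ε : ℝ}
    (hε : 0 < ε) (x : Euc n) :
    ‖gradient (fun x => ReactionDiffusion.smoothAbs ε (φ x)) x‖ ≤ ‖gradient φ x‖ := by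
  rw [norm_gradient, norm_gradient]
  have h1 := ((contDiff_smoothAbs hε).differentiable (by simp) (φ x)).hasDerivAt.comp_hasFDerivAt x
    (h.1.differentiable (by simp) x).hasFDerivAt
  rw [show fderiv ℝ (fun x => ReactionDiffusion.smoothAbs ε (φ x)) x = _ from h1.fderiv, norm_smul]
  exact mul_le_of_le_one_left (norm_nonneg _) (norm_deriv_smoothAbs_le hε _)

/-- The smoothed absolute value is dominated by |s| and has slope at most 1, so neither part of the
norm grows, whatever ε is. -/
theorem IsSpaceTest.norm_toW0_smoothAbs_le {φ : Euc n → ℝ} (h : IsSpaceTest Ω φ) {ε : ℝ}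
    (hε : 0 < ε) : ‖(h.smoothAbs hε).toW0 2‖ ≤ ‖h.toW0 2‖ := by
  rw [norm_W0, norm_W0]
  refine max_le_max (Lp.norm_le_norm_of_ae_le ?_) (Lp.norm_le_norm_of_ae_le ?_)
  · filter_upwards [(h.smoothAbs hε).sobFn_toW0 (p := 2), h.sobFn_toW0 (p := 2)] with x h1 h2
    rw [coeFn_sobFnL, coeFn_sobFnL, h1, h2, Real.norm_eq_abs, Real.norm_eq_abs,
      abs_of_nonneg (smoothAbs_nonneg _ _)]
    exact smoothAbs_le hε _
  · filter_upwards [(h.smoothAbs hε).sobGrad_toW0 (p := 2), h.sobGrad_toW0 (p := 2)] with x h1 h2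
    rw [coeFn_sobGradL, coeFn_sobGradL, h1, h2]
    exact h.norm_gradient_smoothAbs_le hε x

section Extension

variable {h : Euc n → ℝ} (h0 : ∀ x, 0 ≤ h x) (hi : IntegrableOn h Ω) (ℓ : H10 Ω →L[ℝ] ℝ)
  (hℓ : ∀ (φ : Euc n → ℝ) (hφ : IsSpaceTest Ω φ), ∫ x in Ω, φ x * h x = ℓ (hφ.toW0 2))

include h0 hi hℓ

/-- |φ| need not be smooth, so ℓ is applied to its smoothing, whose error is at most ε ∫ h.
Positivity of h turns this into a bound on the absolute integral. -/
theorem integral_abs_mul_le_of_isSpaceTest {φ : Euc n → ℝ} (hφ : IsSpaceTest Ω φ) :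
    ∫ x in Ω, |φ x| * h x ≤ ‖ℓ‖ * ‖hφ.toW0 2‖ := by
  have hbdd : ∀ ψ : Euc n → ℝ, IsSpaceTest Ω ψ → IntegrableOn (fun x => ψ x * h x) Ω := by
    intro ψ hψ
    obtain ⟨B, hB⟩ := hψ.2.1.exists_bound_of_continuous hψ.1.continuous
    exact hi.bdd_mul (c := B) hψ.1.continuous.aestronglyMeasurable (.of_forall hB)
  refine le_of_forall_pos_le_add fun δ hδ => ?_
  set A := ∫ x in Ω, h x with hA
  have hA0 : 0 ≤ A := integral_nonneg h0
  -- Dividing by A + 1 makes ε A ≤ δ even if A = 0.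
  set ε := δ / (A + 1) with hε
  have hεp : 0 < ε := by positivity
  calc ∫ x in Ω, |φ x| * h x ≤ ∫ x in Ω, (smoothAbs ε (φ x) * h x + ε * h x) := by
        refine integral_mono_of_nonneg (.of_forall fun x => mul_nonneg (abs_nonneg _) (h0 x))
          ((hbdd _ (hφ.smoothAbs hεp)).add (hi.const_mul ε)) (.of_forall fun x => ?_)
        have := mul_le_mul_of_nonneg_right (abs_le_smoothAbs_add ε (φ x)) (h0 x)
        beta_reduce
        linarith
    _ = ℓ ((hφ.smoothAbs hεp).toW0 2) + ε * A := by
        rw [integral_add (hbdd _ (hφ.smoothAbs hεp)) (hi.const_mul ε), integral_const_mul,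
          ← hℓ _ (hφ.smoothAbs hεp)]
    _ ≤ ‖ℓ‖ * ‖hφ.toW0 2‖ + δ := by
        have h1 : ℓ ((hφ.smoothAbs hεp).toW0 2) ≤ ‖ℓ‖ * ‖hφ.toW0 2‖ :=
          (le_abs_self _).trans ((ℓ.le_opNorm _).trans
            (mul_le_mul_of_nonneg_left (hφ.norm_toW0_smoothAbs_le hεp) (norm_nonneg _)))
        have h2 : ε * A ≤ δ := by
          rw [hε, div_mul_eq_mul_div, div_le_iff₀ (by positivity)]
          nlinarith
        linarith

/-- Fatou along an almost everywhere convergent sequence of test functions; the lower integral needs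
no prior integrability. -/
theorem lintegral_enorm_mul_le (v : H10 Ω) :
    ∫⁻ x in Ω, ‖sobFn v x * h x‖ₑ ≤ ENNReal.ofReal (‖ℓ‖ * ‖v‖) := by
  obtain ⟨w, hw, hwv⟩ := mem_closure_iff_seq_limit.1 (dense_toW0 2 Ω v)
  obtain ⟨ns, hns, hae⟩ := exists_seq_tendsto_ae_sobFn hwv
  have hk : ∀ k, ∫⁻ x in Ω, ‖sobFn (w k) x * h x‖ₑ ≤ ENNReal.ofReal (‖ℓ‖ * ‖w k‖) := by
    intro k
    obtain ⟨φ, hφ, hk⟩ := hw k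
    rw [hk]
    obtain ⟨B, hB⟩ := hφ.2.1.exists_bound_of_continuous hφ.1.continuous
    have hint : IntegrableOn (fun x => φ x * h x) Ω :=
      hi.bdd_mul (c := B) hφ.1.continuous.aestronglyMeasurable (.of_forall hB)
    calc ∫⁻ x in Ω, ‖sobFn (hφ.toW0 2) x * h x‖ₑ = ∫⁻ x in Ω, ‖φ x * h x‖ₑ := by
          refine lintegral_congr_ae ?_
          filter_upwards [hφ.sobFn_toW0 (p := 2)] with x hx
          rw [hx]
      _ = ENNReal.ofReal (∫ x in Ω, ‖φ x * h x‖) :=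
          (ofReal_integral_norm_eq_lintegral_enorm hint).symm
      _ ≤ _ := by
          refine ENNReal.ofReal_le_ofReal (le_trans (le_of_eq ?_)
            (integral_abs_mul_le_of_isSpaceTest h0 hi ℓ hℓ hφ))
          refine integral_congr_ae (.of_forall fun x => ?_)
          simp [abs_of_nonneg (h0 x)]
  have hlim : Tendsto (fun k => ENNReal.ofReal (‖ℓ‖ * ‖w (ns k)‖)) atTop
      (𝓝 (ENNReal.ofReal (‖ℓ‖ * ‖v‖))) :=
    ENNReal.tendsto_ofReal (((hwv.comp hns.tendsto_atTop).norm).const_mul _)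
  calc ∫⁻ x in Ω, ‖sobFn v x * h x‖ₑ
      = ∫⁻ x in Ω, liminf (fun k => ‖sobFn (w (ns k)) x * h x‖ₑ) atTop := by
        refine lintegral_congr_ae ?_
        filter_upwards [hae] with x hx
        exact ((hx.mul_const (h x)).enorm.liminf_eq).symm
    _ ≤ liminf (fun k => ∫⁻ x in Ω, ‖sobFn (w (ns k)) x * h x‖ₑ) atTop :=
        lintegral_liminf_le' fun k => ((memLp_sobFn (w (ns k))).1.mul hi.1).enorm
    _ ≤ liminf (fun k => ENNReal.ofReal (‖ℓ‖ * ‖w (ns k)‖)) atTop :=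
        liminf_le_liminf (.of_forall fun k => hk (ns k))
    _ = _ := hlim.liminf_eq

theorem integrableOn_sobFn_mul (v : H10 Ω) : IntegrableOn (fun x => sobFn v x * h x) Ω :=
  ⟨(memLp_sobFn v).1.mul hi.1,
    (lintegral_enorm_mul_le h0 hi ℓ hℓ v).trans_lt ENNReal.ofReal_lt_top⟩

/-- If integration against a nonnegative weight agrees on test functions with a bounded functional
on `H₀¹(Ω)`, then it does so on all of `H₀¹(Ω)`. -/
theorem integral_sobFn_mul_eq (v : H10 Ω) : ∫ x in Ω, sobFn v x * h x = ℓ v := by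
  have hI := integrableOn_sobFn_mul h0 hi ℓ hℓ
  -- The absolute bound applied to v - w makes the integral continuous in the H₀¹ norm.
  have hsub : ∀ w : H10 Ω, |(∫ x in Ω, sobFn v x * h x) - ∫ x in Ω, sobFn w x * h x|
      ≤ ‖ℓ‖ * ‖v - w‖ := by
    intro w
    have h1 : (∫ x in Ω, sobFn v x * h x) - ∫ x in Ω, sobFn w x * h x =
        ∫ x in Ω, sobFn (v - w) x * h x := by
      rw [← integral_sub (hI v) (hI w)]
      refine integral_congr_ae ?_
      filter_upwards [sobFn_sub v w] with x hx
      rw [hx, sub_mul]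
    rw [h1, ← Real.norm_eq_abs]
    refine (norm_integral_le_lintegral_norm _).trans ?_
    refine ENNReal.toReal_le_of_le_ofReal (by positivity) ?_
    simp only [ofReal_norm]
    exact lintegral_enorm_mul_le h0 hi ℓ hℓ (v - w)
  obtain ⟨w, hw, hwv⟩ := mem_closure_iff_seq_limit.1 (dense_toW0 2 Ω v)
  have hlim : Tendsto (fun k => ∫ x in Ω, sobFn (w k) x * h x) atTop
      (𝓝 (∫ x in Ω, sobFn v x * h x)) := by
    rw [tendsto_iff_norm_sub_tendsto_zero]
    refine squeeze_zero (fun _ => norm_nonneg _) (fun k => ?_)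
      (g := fun k => ‖ℓ‖ * ‖w k - v‖) ?_
    · rw [norm_sub_rev, Real.norm_eq_abs, norm_sub_rev]
      exact hsub (w k)
    · simpa using (tendsto_iff_norm_sub_tendsto_zero.1 hwv).const_mul ‖ℓ‖
  refine tendsto_nhds_unique hlim (((ℓ.continuous.tendsto v).comp hwv).congr fun k => ?_)
  obtain ⟨φ, hφ, hk⟩ := hw k
  rw [Function.comp_apply, hk, ← hℓ φ hφ]
  refine integral_congr_ae ?_
  filter_upwards [hφ.sobFn_toW0 (p := 2)] with x hx
  rw [hx]

end Extension

end NonnegativeDensity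

/-! ### The energy and dissipation identities. -/

section Identities

variable {n : ℕ} {T r : ℝ} [hr : Fact (2 ≤ r)] {Ω : Set (Euc n)} {f : ℝ → Euc n → ℝ → ℝ}
  [IsFiniteMeasure ((volume : Measure (Euc n)).restrict Ω)]

attribute [local irreducible] sobMul inclusionW0 weakForm

/-- The weak equation, tested with the product of a test function and the solution. -/
theorem integral_test_mul_eq_zero {C : ℝ} (hC0 : 0 ≤ C)
    (hC : ∀ u : W0 (ENNReal.ofReal r) Ω, ∀ᵐ x ∂(volume.restrict Ω), |sobFn u x| ≤ C * ‖u‖)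
    (u a : W0 (ENNReal.ofReal r) Ω) {F : Euc n → ℝ}
    (heq : ∀ v : H10 Ω, ∫ x in Ω, (sobFn v x * (sobFn a x - F x) + ⟪sobGrad v x, sobGrad u x⟫) = 0)
    {φ : Euc n → ℝ} (hφ : IsSpaceTest Ω φ) :
    ∫ x in Ω, (φ x * ‖sobGrad u x‖ ^ 2 + (φ x * (sobFn u x * (sobFn a x - F x))
      + ⟪gradient φ x, sobFn u x • sobGrad u x⟫)) = 0 := by
  -- The test function is φu ∈ W₀^{1,r} ⊂ H₀¹; the part φ∇u of its gradient produces the weight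
  -- φ|∇u|².
  refine Eq.trans ?_ (heq (inclusionW0 (two_le_ofReal r) (sobMul hC0 hC (hφ.toW0 _) u)))
  refine integral_congr_ae ?_
  filter_upwards [hφ.sobFn_toW0 (p := ENNReal.ofReal r), hφ.sobGrad_toW0 (p := ENNReal.ofReal r),
    sobFn_inclusionW0 (two_le_ofReal r) (sobMul hC0 hC (hφ.toW0 _) u),
    sobGrad_inclusionW0 (two_le_ofReal r) (sobMul hC0 hC (hφ.toW0 _) u),
    sobFn_sobMul hC0 hC (hφ.toW0 _) u, sobGrad_sobMul hC0 hC (hφ.toW0 _) u]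
    with x h3 h4 h5 h6 h7 h8
  simp only [h5, h6, h7, h8, h3, h4]
  rw [inner_add_left, real_inner_smul_left, real_inner_smul_left,
    real_inner_smul_right, real_inner_self_eq_norm_sq]
  ring

/-- The energy identity on a time slice: the square of a solution `u` of `a - Δu = F`. -/
theorem slice_energy_identity {C : ℝ} (hC0 : 0 ≤ C)
    (hC : ∀ u : W0 (ENNReal.ofReal r) Ω, ∀ᵐ x ∂(volume.restrict Ω), |sobFn u x| ≤ C * ‖u‖)
    (u a : W0 (ENNReal.ofReal r) Ω) {F : Euc n → ℝ} (hF : MemLp F ⊤ (volume.restrict Ω))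
    (heq : ∀ v : H10 Ω, ∫ x in Ω, (sobFn v x * (sobFn a x - F x) + ⟪sobGrad v x, sobGrad u x⟫) = 0)
    (v : H10 Ω) :
    IntegrableOn (fun x => (sobFn v x * (sobFn u x * (sobFn a x - F x))
      + ⟪sobGrad v x, sobFn u x • sobGrad u x⟫) + sobFn v x * ‖sobGrad u x‖ ^ 2) Ω ∧
    ∫ x in Ω, ((sobFn v x * (sobFn u x * (sobFn a x - F x))
      + ⟪sobGrad v x, sobFn u x • sobGrad u x⟫) + sobFn v x * ‖sobGrad u x‖ ^ 2) = 0 := by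
  have hu : MemLp (sobFn u) ⊤ (volume.restrict Ω) := memLp_top_sobFn hC u
  -- Since u is bounded, u(a - F) and u∇u are in L², so the functional representing the weight |∇u|²
  -- is bounded on H₀¹.
  have ha : MemLp (fun x => sobFn u x * (sobFn a x - F x)) 2 (volume.restrict Ω) :=
    MemLp.mul ((memLp_two_sobFn a).sub (hF.mono_exponent le_top)) hu
  have hb : MemLp (fun x => sobFn u x • sobGrad u x) 2 (volume.restrict Ω) :=
    MemLp.smul (memLp_two_sobGrad u) hu
  have hi : IntegrableOn (fun x => ‖sobGrad u x‖ ^ 2) Ω :=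
    (memLp_two_sobGrad u).norm.integrable_sq
  have h0 : ∀ x, 0 ≤ ‖sobGrad u x‖ ^ 2 := fun x => by positivity
  have hℓ : ∀ (φ : Euc n → ℝ) (hφ : IsSpaceTest Ω φ),
      ∫ x in Ω, φ x * ‖sobGrad u x‖ ^ 2 = (-weakForm ha hb) (hφ.toW0 2) := by
    intro φ hφ
    obtain ⟨B, hB⟩ := hφ.2.1.exists_bound_of_continuous hφ.1.continuous
    have i1 : IntegrableOn (fun x => φ x * ‖sobGrad u x‖ ^ 2) Ω :=
      hi.bdd_mul (c := B) hφ.1.continuous.aestronglyMeasurable (.of_forall hB)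
    rw [neg_apply, weakForm_apply, eq_neg_iff_add_eq_zero,
      ← integral_add i1 (integrable_weakForm ha hb _)]
    refine Eq.trans ?_ (integral_test_mul_eq_zero hC0 hC u a heq hφ)
    refine integral_congr_ae ?_
    filter_upwards [hφ.sobFn_toW0 (p := 2), hφ.sobGrad_toW0 (p := 2)] with x h1 h2
    simp only [h1, h2]
  have i1 := integrableOn_sobFn_mul h0 hi (-weakForm ha hb) hℓ v
  have i2 := integrable_weakForm ha hb v
  refine ⟨i2.add i1, ?_⟩
  rw [integral_add i2 i1, integral_sobFn_mul_eq h0 hi (-weakForm ha hb) hℓ v, neg_apply,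
    weakForm_apply, add_neg_cancel]

variable (r Ω) in
/-- The gradient, as a map `W₀^{1,r}(Ω) → L²(Ω)ⁿ`. -/
def sobGradTwoL : W0 (ENNReal.ofReal r) Ω →L[ℝ] Lp (Euc n) 2 (volume.restrict Ω) :=
  (lpInclusion (Euc n) (volume.restrict Ω) (two_le_ofReal r)).comp (sobGradL (ENNReal.ofReal r) Ω)

theorem coeFn_sobGradTwoL (u : W0 (ENNReal.ofReal r) Ω) :
    sobGradTwoL r Ω u =ᵐ[volume.restrict Ω] sobGrad u :=
  coeFn_lpInclusion (two_le_ofReal r) (sobGradL (ENNReal.ofReal r) Ω u)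

attribute [local irreducible] sobGradTwoL

variable (r Ω) in
/-- The Dirichlet form `(u, w) ↦ ∫ ∇u · ∇w` on `W₀^{1,r}(Ω)`. -/
def dirichletForm : W0 (ENNReal.ofReal r) Ω →L[ℝ] W0 (ENNReal.ofReal r) Ω →L[ℝ] ℝ :=
  innerPullback (sobGradTwoL r Ω)

theorem dirichletForm_apply (u w : W0 (ENNReal.ofReal r) Ω) :
    dirichletForm r Ω u w = ∫ x in Ω, ⟪sobGrad u x, sobGrad w x⟫ := by
  rw [dirichletForm, innerPullback_apply, L2.inner_def]
  refine integral_congr_ae ?_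
  filter_upwards [coeFn_sobGradTwoL u, coeFn_sobGradTwoL w] with x h1 h2
  simp only [h1, h2]

/-- The dissipation identity on a time slice, tested with `a` in `a - Δu = F`. -/
theorem slice_dissipation_identity (u a : W0 (ENNReal.ofReal r) Ω) {F : Euc n → ℝ}
    (hF : MemLp F ⊤ (volume.restrict Ω))
    (heq : ∀ v : H10 Ω, ∫ x in Ω, (sobFn v x * (sobFn a x - F x) + ⟪sobGrad v x, sobGrad u x⟫) = 0)
    (c d : ℝ) :
    IntegrableOn (fun x => c * sobFn a x ^ 2 - 1 / 2 * d * ‖sobGrad u x‖ ^ 2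
      - c * sobFn a x * F x) Ω ∧
    ∫ x in Ω, (c * sobFn a x ^ 2 - 1 / 2 * d * ‖sobGrad u x‖ ^ 2 - c * sobFn a x * F x) =
      - (c * dirichletForm r Ω a u + 1 / 2 * (d * dirichletForm r Ω u u)) := by
  have hi : IntegrableOn (fun x => ‖sobGrad u x‖ ^ 2) Ω :=
    (memLp_two_sobGrad u).norm.integrable_sq
  have hg : IntegrableOn (fun x => ⟪sobGrad a x, sobGrad u x⟫) Ω :=
    integrable_inner_of_memLp_two (memLp_two_sobGrad a) (memLp_two_sobGrad u)
  have hm : IntegrableOn (fun x => sobFn a x * (sobFn a x - F x)) Ω :=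
    integrable_mul_of_memLp_two (memLp_two_sobFn a)
      ((memLp_two_sobFn a).sub (hF.mono_exponent le_top))
  -- Here the slice equation is tested with a itself, through W₀^{1,r} ⊂ H₀¹.
  have h1 : ∫ x in Ω, sobFn a x * (sobFn a x - F x) = -dirichletForm r Ω a u := by
    refine eq_neg_of_add_eq_zero_left ((congrArg _ (dirichletForm_apply a u)).trans ?_)
    refine (integral_add hm hg).symm.trans (Eq.trans ?_ (heq (inclusionW0 (two_le_ofReal r) a)))
    refine integral_congr_ae ?_
    filter_upwards [sobFn_inclusionW0 (two_le_ofReal r) a,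
      sobGrad_inclusionW0 (two_le_ofReal r) a] with x h1 h2
    simp only [h1, h2]
  have h2 : ∫ x in Ω, ‖sobGrad u x‖ ^ 2 = dirichletForm r Ω u u := by
    simp only [dirichletForm_apply, real_inner_self_eq_norm_sq]
  have e : ∀ x, c * (sobFn a x * (sobFn a x - F x)) - 1 / 2 * d * ‖sobGrad u x‖ ^ 2 =
      c * sobFn a x ^ 2 - 1 / 2 * d * ‖sobGrad u x‖ ^ 2 - c * sobFn a x * F x := fun x => by ring
  have j1 := hm.const_mul c
  have j2 := hi.const_mul (1 / 2 * d)
  refine ⟨(j1.sub j2).congr (.of_forall e), ?_⟩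
  refine (integral_congr_ae (.of_forall e)).symm.trans ((integral_sub j1 j2).trans ?_)
  simp only [integral_const_mul, h1, h2]
  ring

theorem dirichletForm_comm (u w : W0 (ENNReal.ofReal r) Ω) :
    dirichletForm r Ω u w = dirichletForm r Ω w u := by
  simp only [dirichletForm_apply, real_inner_comm]

/-- The inner integral vanishes for almost every t, so φ only enters as a scalar on each slice and
may be arbitrary. -/
theorem IsWeakSolution.exists_sq_energy_identity {C : ℝ} (hC0 : 0 ≤ C)
    (hC : ∀ u : W0 (ENNReal.ofReal r) Ω, ∀ᵐ x ∂(volume.restrict Ω), |sobFn u x| ≤ C * ‖u‖)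
    (hf : IsLocallyBounded T Ω f) {y₀ : W0 (ENNReal.ofReal r) Ω} {y : Xr T r Ω}
    (hy : IsWeakSolution f y₀ y) :
    ∃ z : Xr T r Ω,
      (∀ᵐ t ∂(volume.restrict (Ioo 0 T)), ∀ᵐ x ∂(volume.restrict Ω), z.fn t x = y.fn t x ^ 2) ∧
      ∀ (v : H10 Ω) (φ : ℝ → ℝ), IteratedIntegralEqZero T Ω (fun t x =>
          φ t * (sobFn v x * z.timeDeriv t x + ⟪sobGrad v x, z.spaceGrad t x⟫
            - 2 * sobFn v x * y.fn t x * f t x (y.fn t x)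
            + 2 * sobFn v x * ‖y.spaceGrad t x‖ ^ 2)) := by
  obtain ⟨R, hR⟩ := hy.exists_ae_norm_le
  refine ⟨H1Bochner.bilinSelf y (sobMul hC0 hC) hR, .of_forall fun t => ?_, fun v φ => ?_⟩
  · filter_upwards [sobFn_sobMul hC0 hC (y.val t) (y.val t)] with x hx
    exact hx.trans (sq _).symm
  have key : ∀ᵐ t ∂(volume.restrict (Ioo 0 T)), IntegrableOn (fun x =>
      φ t * (sobFn v x * Xr.timeDeriv (H1Bochner.bilinSelf y (sobMul hC0 hC) hR) t x +
        ⟪sobGrad v x, Xr.spaceGrad (H1Bochner.bilinSelf y (sobMul hC0 hC) hR) t x⟫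
            - 2 * sobFn v x * y.fn t x * f t x (y.fn t x)
            + 2 * sobFn v x * ‖y.spaceGrad t x‖ ^ 2)) Ω ∧
      ∫ x in Ω, φ t * (sobFn v x * Xr.timeDeriv (H1Bochner.bilinSelf y (sobMul hC0 hC) hR) t x +
        ⟪sobGrad v x, Xr.spaceGrad (H1Bochner.bilinSelf y (sobMul hC0 hC) hR) t x⟫
            - 2 * sobFn v x * y.fn t x * f t x (y.fn t x)
            + 2 * sobFn v x * ‖y.spaceGrad t x‖ ^ 2) = 0 := by
    filter_upwards [hy.ae_weak_eq hC0 hC hf] with t ht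
    obtain ⟨i, h⟩ := slice_energy_identity hC0 hC (y.val t) (y.dt t) ht.1 ht.2 v
    -- With ∂ₜ(y²) = 2y∂ₜy and ∇(y²) = 2y∇y, the integrand is 2φ(t) times that of the slice
    -- identity.
    have e : (fun x => φ t * (2 * ((sobFn v x * (sobFn (y.val t) x * (sobFn (y.dt t) x
        - f t x (y.fn t x))) + ⟪sobGrad v x, sobFn (y.val t) x • sobGrad (y.val t) x⟫)
        + sobFn v x * ‖sobGrad (y.val t) x‖ ^ 2))) =ᵐ[volume.restrict Ω]
        fun x => φ t * (sobFn v x * Xr.timeDeriv (H1Bochner.bilinSelf y (sobMul hC0 hC) hR) t x +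
        ⟪sobGrad v x, Xr.spaceGrad (H1Bochner.bilinSelf y (sobMul hC0 hC) hR) t x⟫
            - 2 * sobFn v x * y.fn t x * f t x (y.fn t x)
            + 2 * sobFn v x * ‖y.spaceGrad t x‖ ^ 2) := by
      filter_upwards [sobGrad_sobMul hC0 hC (y.val t) (y.val t),
        sobFn_sobMul hC0 hC (y.val t) (y.dt t), sobFn_sobMul hC0 hC (y.dt t) (y.val t),
        sobFn_add (sobMul hC0 hC (y.dt t) (y.val t)) (sobMul hC0 hC (y.val t) (y.dt t))]
        with x h1 h2 h3 h4
      have h5 : Xr.spaceGrad (H1Bochner.bilinSelf y (sobMul hC0 hC) hR) t x =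
        sobFn (y.val t) x • sobGrad (y.val t) x + sobFn (y.val t) x • sobGrad (y.val t) x := h1
      have h6 : Xr.timeDeriv (H1Bochner.bilinSelf y (sobMul hC0 hC) hR) t x =
        sobFn (y.dt t) x * sobFn (y.val t) x + sobFn (y.val t) x * sobFn (y.dt t) x := by
        exact h4.trans (congrArg₂ (· + ·) h3 h2)
      simp only [h5, h6, inner_add_right]
      simp only [Xr.fn, Xr.spaceGrad]
      ring
    refine ⟨((i.const_mul 2).const_mul (φ t)).congr e, ?_⟩
    rw [← integral_congr_ae e, integral_const_mul, integral_const_mul, h, mul_zero, mul_zero]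
  refine ⟨key.mono fun t h => h.1, ?_, ?_⟩
  · exact (integrable_zero ℝ ℝ _).congr (key.mono fun t h => h.2.symm)
  · rw [integral_congr_ae (key.mono fun t h => h.2), integral_zero]

/-- With D the Dirichlet form, each slice integrates to -(φ D(∂ₜy, y) + ½ φ' D(y, y)). This is -½
times the time derivative of φ D(y, y), which integrates to zero because φ has compact support in
(0,T). -/
theorem IsWeakSolution.dissipation_identity {C : ℝ} (hC0 : 0 ≤ C)
    (hC : ∀ u : W0 (ENNReal.ofReal r) Ω, ∀ᵐ x ∂(volume.restrict Ω), |sobFn u x| ≤ C * ‖u‖)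
    (hf : IsLocallyBounded T Ω f) {y₀ : W0 (ENNReal.ofReal r) Ω} {y : Xr T r Ω}
    (hy : IsWeakSolution f y₀ y) {φ : ℝ → ℝ} (hφ : IsTimeTest T φ) :
    IteratedIntegralEqZero T Ω (fun t x =>
        φ t * y.timeDeriv t x ^ 2 - 1 / 2 * deriv φ t * ‖y.spaceGrad t x‖ ^ 2
          - φ t * y.timeDeriv t x * f t x (y.fn t x)) := by
  have key := (hy.ae_weak_eq hC0 hC hf).mono fun t ht =>
    slice_dissipation_identity (y.val t) (y.dt t) ht.1 ht.2 (φ t) (deriv φ t)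
  obtain ⟨i, h⟩ := y.integral_symm_bilin (dirichletForm r Ω) dirichletForm_comm hφ
  exact ⟨key.mono fun t ht => ht.1, i.congr (key.mono fun t ht => ht.2.symm),
    (integral_congr_ae (key.mono fun t ht => ht.2)).trans h⟩

end Identities

end ReactionDiffusion

end

theorem proposition3p5 {n : ℕ} (hn : 1 ≤ n) {T : ℝ} (hT : 0 < T)
    (Ω : Set (Euc n)) (hΩo : IsOpen Ω) (hΩb : Bornology.IsBounded Ω)
    (hΩl : HasLipschitzBoundary Ω)
    (r : ℝ) [Fact (2 ≤ r)] (hrn : (n : ℝ) < r)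
    (f : ℝ → Euc n → ℝ → ℝ) (hf : IsLocallyBounded T Ω f)
    (hf' : IsLocallyOneSidedLipschitz T Ω f)
    (y₀ : W0 (ENNReal.ofReal r) Ω) (y : Xr T r Ω) (hy : IsWeakSolution f y₀ y) :
    -- the square of `y` is an element `z` of `X_r`, which satisfies the energy identity
    (∃ z : Xr T r Ω,
      (∀ᵐ t ∂(volume.restrict (Ioo 0 T)), ∀ᵐ x ∂(volume.restrict Ω), z.fn t x = y.fn t x ^ 2) ∧
      ∀ (v : H10 Ω) (φ : ℝ → ℝ), IsTimeTest T φ →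
        IteratedIntegralEqZero T Ω (fun t x =>
          φ t * (sobFn v x * z.timeDeriv t x + ⟪sobGrad v x, z.spaceGrad t x⟫
            - 2 * sobFn v x * y.fn t x * f t x (y.fn t x)
            + 2 * sobFn v x * ‖y.spaceGrad t x‖ ^ 2))) ∧
    -- the dissipation identity
    (∀ φ : ℝ → ℝ, IsTimeTest T φ →
      IteratedIntegralEqZero T Ω (fun t x =>
        φ t * y.timeDeriv t x ^ 2 - 1 / 2 * deriv φ t * ‖y.spaceGrad t x‖ ^ 2
          - φ t * y.timeDeriv t x * f t x (y.fn t x))) := by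
  have := isFiniteMeasure_restrict_of_isBounded hΩb
  obtain ⟨C, hC0, hC⟩ := exists_ae_abs_sobFn_le hn hrn hΩb
  obtain ⟨z, hz, h⟩ := hy.exists_sq_energy_identity hC0 hC hf
  exact ⟨⟨z, hz, fun v φ _ => h v φ⟩, fun φ hφ => hy.dissipation_identity hC0 hC hf hφ⟩
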